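/- Let $\alpha_\ell=(-4)^{-\ell}\binom{2\ell}{\ell}$, so that $(1+x^2)^{-1/2}=\sum_{\ell\ge 0}\alpha_\ell x^{2\ell}$. For a function $f$ on the positive integers let $L_f(q)=\sum_{d\ge 1}f(d)\frac{q^d}{1-q^d}$ be its Lambert series, a formal power series in $q$. Define the moment series $c(j)(q)$ by $c(j)=0$ for $j$ odd and $$c(2k)(q)=(-1)^k\,\partial_x^{2k}\Big(\tfrac{1}{\sqrt{e^{-x}+e^{x}}}\Big)_{x=0}+(-1)^kL_{f_k}(q),\qquad f_k(2\ell+1)=2\left(\tfrac12+2\ell\right)^{2k}\alpha_\ell,\quad f_k(2\ell)=0 .$$ For $n\ge 0$ let $\mathcal D_n(q)=(c(i+j)(q))_{0\le i,j\le n}$ and $\mathcal A_n(q)=\mathcal D_n(0)^{-1}(\mathcal D_n(q)-\mathcal D_n(0))$. Let $\mathcal H_n^+$ (resp. $\mathcal H_n^-$) be the space of vectors $(\xi_0,\dots,\xi_n)$ whose odd (resp. even) coordinates vanish. Put $$\mathcal P_m(x)=\sqrt{(2m)!}\sum_{k=0}^m(-1)^k2^{3k-m}\frac{\prod_{j=0}^{k-1}\left(j-\frac{ix}{2}+\frac14\right)}{(2k)!\,(m-k)!},\qquad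 \eta_\ell(m)=\mathcal P_m\!\left(-i(\tfrac12+2\ell)\right)\in\mathbb R,$$ let $\eta_\ell^\pm\in\mathcal H_n^\pm$ be the vector with coordinates $\eta_\ell(m)$ for the $m\in\{0,\dots,n\}$ with $(-1)^m=\pm1$, and let $$\mathcal A_n^\pm(q)=\pm 2^{3/2}\sum_{\ell\ge 0}\alpha_\ell\,\frac{q^{2\ell+1}}{1-q^{2\ell+1}}\,|\eta_\ell^\pm\rangle\langle\eta_\ell^\pm|,$$ a matrix with entries in $\mathbb C[[q]]$ acting on $\mathcal H_n^\pm$. For every $n\ge 0$ the following hold. (a) $\mathcal D_n(0)$ is invertible, and $\mathcal A_n(q)$ is conjugate by an invertible complex matrix to $\mathcal A_n^+(q)\oplus\mathcal A_n^-(q)$. (b) For each sign, with $N=\dim\mathcal H_n^\pm$, the eigenvalues of $\mathcal A_n^\pm(q)$ (the roots of its characteristic polynomial, with multiplicity) are formal power series $$\lambda_n^\pm(k)=\sum_{j\ge 2k+1}\lambda_n^\pm(k,j)\,q^j,\qquad 0\le k<N,$$ and every coefficient $\lambda_n^\pm(k,j)$ is a rational multiple of $\sqrt2$. (c) For each sign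 and each $m\ge 0$, $\mathrm{Tr}(\wedge^m\mathcal A_n^\pm(q))=c_{n,m}^\pm q^{m^2}+O(q^{m^2+1})$, where $$c_{n,m}^\pm=(-1)^{m(m\mp1)/2}\,2^{3m/2}\det_{0\le\ell,\ell'<m}\left(\langle\xi_{n,\ell}^\pm,\xi_{n,\ell'}^\pm\rangle\right).$$ Here $\xi_{n,\ell}^\pm\in\mathcal H_n^\pm$ has the coordinates $2^{-\ell-i}\sqrt{\sigma(\ell,i)}$ for $i\in\{0,\dots,n\}$ with $(-1)^i=\pm1$, and $$\sigma(\ell,m)=\binom{2\ell}{\ell}\binom{2m}{m}p_\ell(m)^2,\qquad p_\ell(m)=\sum_{k=0}^{\ell}2^{3k}\binom mk\binom\ell k\binom{2k}{k}^{-1}.$$ Moreover $c_{n,m}^\pm\neq 0$ for $m\le N$. -/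

import Mathlib

open scoped PowerSeries Matrix

noncomputable section

namespace SemilocalQ

/-- The Taylor coefficients of `1/√(1+x²) = ∑ α_ℓ x^{2ℓ}`: `α_ℓ = (-4)^{-ℓ} (2ℓ choose ℓ)`. -/
def alpha (l : ℕ) : ℂ := ((-4 : ℂ) ^ l)⁻¹ * (Nat.choose (2 * l) l : ℂ)

/-- The Lambert series `L_f(q) = ∑_{d ≥ 1} f(d) q^d / (1 - q^d) = ∑_{N ≥ 1} (∑_{d ∣ N} f(d)) q^N`,
as a formal power series in `q` (only the values of `f` at positive integers matter; the constant
term is `0` because `Nat.divisors 0 = ∅`). -/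
def lambertSeries (f : ℕ → ℂ) : ℂ⟦X⟧ :=
  PowerSeries.mk fun N => ∑ d ∈ N.divisors, f d

/-- The unnormalised even archimedean moments
`c₀(2k) = (-1)^k (d/dx)^{2k} (e^{-x} + e^x)^{-1/2}` at `x = 0`. -/
def archMoment (k : ℕ) : ℝ :=
  (-1) ^ k * iteratedDeriv (2 * k) (fun x : ℝ => 1 / √(Real.exp (-x) + Real.exp x)) 0

/-- The function `f_k` with `f_k(2ℓ+1) = 2 (1/2 + 2ℓ)^{2k} α_ℓ` and `f_k(2ℓ) = 0`. -/
def momentFun (k d : ℕ) : ℂ :=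
  if Odd d then 2 * (1 / 2 + 2 * ((d / 2 : ℕ) : ℂ)) ^ (2 * k) * alpha (d / 2) else 0

/-- The `q`-series of the `j`-th moment: zero for `j` odd and
`c(2k) = c₀(2k) + (-1)^k L_{f_k}(q)` for `j = 2k`. -/
def momentSeries (j : ℕ) : ℂ⟦X⟧ :=
  if Even j then
    PowerSeries.C (archMoment (j / 2) : ℂ) + (-1) ^ (j / 2) * lambertSeries (momentFun (j / 2))
  else 0

/-- The Hankel matrix `D_n(q) = (c(i+j))_{0 ≤ i, j ≤ n}`. -/
def hankel (n : ℕ) : Matrix (Fin (n + 1)) (Fin (n + 1)) ℂ⟦X⟧ :=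
  Matrix.of fun i j => momentSeries ((i : ℕ) + (j : ℕ))

/-- The value `D_n(0)` of the Hankel matrix at `q = 0`. -/
def hankelZero (n : ℕ) : Matrix (Fin (n + 1)) (Fin (n + 1)) ℂ :=
  (hankel n).map (PowerSeries.constantCoeff (R := ℂ))

/-- `A_n(q) = D_n(0)⁻¹ (D_n(q) - D_n(0))`. -/
def qMatrix (n : ℕ) : Matrix (Fin (n + 1)) (Fin (n + 1)) ℂ⟦X⟧ :=
  ((hankelZero n)⁻¹).map (PowerSeries.C (R := ℂ)) *
    (hankel n - (hankelZero n).map (PowerSeries.C (R := ℂ)))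

/-- The polynomials
`P_m(x) = √((2m)!) ∑_{k=0}^m (-1)^k 2^{3k-m} ∏_{j<k} (j - ix/2 + 1/4) / ((2k)! (m-k)!)`. -/
def orthoPoly (m : ℕ) (x : ℂ) : ℂ :=
  (√((2 * m).factorial : ℝ) : ℂ) *
    ∑ k ∈ Finset.range (m + 1),
      (-1) ^ k * (2 : ℂ) ^ (3 * (k : ℤ) - (m : ℤ)) *
        (∏ j ∈ Finset.range k, ((j : ℂ) - Complex.I * x / 2 + 1 / 4)) /
        (((2 * k).factorial : ℂ) * ((m - k).factorial : ℂ))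

/-- `η_ℓ(m) = P_m(-i(1/2 + 2ℓ))`. -/
def eta (l m : ℕ) : ℂ := orthoPoly m (-Complex.I * (1 / 2 + 2 * (l : ℂ)))

/-- The coordinates of the space `H_n^±` of vectors `(ξ_0, …, ξ_n)` whose odd (for the sign `1`),
respectively even (for the sign `-1`), coordinates vanish: the indices `0 ≤ i ≤ n` with
`(-1)^i = s`. -/
abbrev ParityIndex (n : ℕ) (s : ℤˣ) : Type :=
  {i : Fin (n + 1) // (-1 : ℤˣ) ^ (i : ℕ) = s}

/-- The rank one operator `T_ℓ^± = ± 2^{3/2} |η_ℓ^±⟩⟨η_ℓ^±|` on `H_n^±`. -/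
def rankOne (n : ℕ) (s : ℤˣ) (l : ℕ) : Matrix (ParityIndex n s) (ParityIndex n s) ℂ :=
  (((s : ℤ) : ℂ) * (2 * (√2 : ℝ))) •
    Matrix.vecMulVec (fun i : ParityIndex n s => eta l i.1)
      (star fun i : ParityIndex n s => eta l i.1)

/-- The `q`-matrix `A_n^±(q) = ∑_{ℓ ≥ 0} α_ℓ (q^{2ℓ+1} / (1 - q^{2ℓ+1})) T_ℓ^±`
acting on `H_n^±`. -/
def qMatrixSign (n : ℕ) (s : ℤˣ) : Matrix (ParityIndex n s) (ParityIndex n s) ℂ⟦X⟧ :=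
  Matrix.of fun i j =>
    lambertSeries fun d => if Odd d then alpha (d / 2) * rankOne n s (d / 2) i j else 0

/-- The direct sum `A_n^+(q) ⊕ A_n^-(q)` as an operator on `H_n = H_n^+ ⊕ H_n^-`. -/
def qMatrixSum (n : ℕ) : Matrix (Fin (n + 1)) (Fin (n + 1)) ℂ⟦X⟧ :=
  Matrix.reindex (Equiv.sigmaFiberEquiv fun i : Fin (n + 1) => (-1 : ℤˣ) ^ (i : ℕ))
    (Equiv.sigmaFiberEquiv fun i : Fin (n + 1) => (-1 : ℤˣ) ^ (i : ℕ))
    (Matrix.blockDiagonal' fun s : ℤˣ => qMatrixSign n s)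

/-- `Tr(∧^m A)`, the trace of the `m`-th exterior power of a square matrix. -/
def traceWedge {R ι : Type*} [CommRing R] [Fintype ι] [DecidableEq ι] (m : ℕ)
    (A : Matrix ι ι R) : R :=
  LinearMap.trace R (⋀[R]^m (ι → R)) (exteriorPower.map m (Matrix.toLin' A))

/-- `p_ℓ(m) = ∑_{k=0}^ℓ 2^{3k} (m choose k) (ℓ choose k) (2k choose k)⁻¹`. -/
def pPoly (l m : ℕ) : ℝ :=
  ∑ k ∈ Finset.range (l + 1),
    2 ^ (3 * k) * (Nat.choose m k : ℝ) * (Nat.choose l k : ℝ) / (Nat.choose (2 * k) k : ℝ)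

/-- `σ(ℓ,m) = (2ℓ choose ℓ) (2m choose m) p_ℓ(m)²`. -/
def sigmaCoeff (l m : ℕ) : ℝ :=
  (Nat.choose (2 * l) l : ℝ) * (Nat.choose (2 * m) m : ℝ) * pPoly l m ^ 2

/-- The vector `ξ_{n,ℓ}^± ∈ H_n^±` with coordinates `2^{-ℓ-i} √σ(ℓ,i)`. -/
def xi (n : ℕ) (s : ℤˣ) (l : ℕ) (i : ParityIndex n s) : ℝ :=
  (2 ^ (l + (i.1 : ℕ)))⁻¹ * √(sigmaCoeff l i.1)

/-- The Gram determinant `det (⟨ξ_{n,ℓ}^±, ξ_{n,ℓ'}^±⟩)_{0 ≤ ℓ, ℓ' < m}`. -/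
def gramDet (n : ℕ) (s : ℤˣ) (m : ℕ) : ℝ :=
  (Matrix.of fun a b : Fin m => xi n s a ⬝ᵥ xi n s b).det

/-- The coefficients `c_{n,m}^+ = (-1)^{m(m-1)/2} 2^{3m/2} det(…)` and
`c_{n,m}^- = (-1)^{m(m+1)/2} 2^{3m/2} det(…)`. -/
def leadCoeff (n : ℕ) (s : ℤˣ) (m : ℕ) : ℝ :=
  (-1) ^ (if s = 1 then m * (m - 1) / 2 else m * (m + 1) / 2) * (2 * √2) ^ m * gramDet n s m

end SemilocalQ

end

noncomputable section

namespace SemilocalQ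

/-! Part (a) is a change of basis. The q^0 coefficient of c(j) is i^j F(X^j) with F(p) = (p(∂)g)(0)
and g = (e^{-x}+e^x)^{-1/2}; for N ≥ 1 the q^N coefficient has the same shape, with F replaced by a
combination of evaluations at ±(1/2+2ℓ). The polynomials 𝒫_m(-iX) are rescaled Meixner polynomials
₂F₁(-m,-θ;1/2;2), X = 1/2+2θ. They are orthogonal for F with squares (-1)^m/√2, so they diagonalise
D_n(0) and turn D_n(q) - D_n(0) into a sum of rank one terms η_ℓ η_ℓᵀ. Their parity in X separates
even from odd indices (`qMatrix_similar`).

For (c), Tr ∧^m is the sum of the principal m-minors. For ∑ w_ℓ v_ℓ v_ℓᵀ with w_ℓ of order 2ℓ+1 in q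
this is a sum over m-sets S of ∏_{S} w_ℓ times a Gram determinant. The order ∑_{S} (2ℓ+1) is least,
equal to m², only for S = {0,…,m-1} (`X_pow_dvd_sumMinors_sub_lead`). The Gram determinant is
nonzero for m ≤ N because p_ℓ is a polynomial of degree ℓ in the index (`gramDet_ne_zero`).

For (b), the coefficients of the characteristic polynomial thus have orders exactly m², so its
Newton polygon has slopes 1, 3, 5, …, each of length one, and Hensel's lemma splits it over the
power series (`exists_eq_prod_of_coeff_eq`). A diagonal conjugation makes A_n^±/√2 rational;
splitting over ℚ⟦X⟧ gives the rationality of the coefficients. -/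

/-! ### Hensel's lemma and splitting along the Newton polygon -/

-- Modulo X the root -c is simple, since c ≠ 0, so Hensel's lemma lifts it; the lift has constant
-- term -c and is a unit.
open Polynomial in
theorem exists_isRoot_of_map_constantCoeff {K : Type*} [Field K] {M : ℕ}
    (g : K⟦X⟧[X]) (hg : g.Monic) (c : K) (hc : c ≠ 0)
    (h : g.map PowerSeries.constantCoeff = Polynomial.X ^ M * (Polynomial.X + Polynomial.C c)) :
    ∃ y : K⟦X⟧, IsUnit y ∧ g.IsRoot y := by
  have hI : ∀ z : K⟦X⟧, z ∈ Ideal.span {(PowerSeries.X : K⟦X⟧)} ↔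
      PowerSeries.constantCoeff z = 0 := fun z => by
    rw [Ideal.mem_span_singleton, PowerSeries.X_dvd_iff]
  have ev : ∀ f : K⟦X⟧[X], ∀ z, PowerSeries.constantCoeff (f.eval z) =
      (f.map PowerSeries.constantCoeff).eval (PowerSeries.constantCoeff z) := fun f z => by
    rw [Polynomial.eval_map, Polynomial.eval₂_at_apply]
  obtain ⟨y, hy, hy'⟩ := HenselianRing.is_henselian (I := Ideal.span {(PowerSeries.X : K⟦X⟧)})
    g hg (PowerSeries.C (-c)) (by rw [hI, ev, h]; simp) (by
      apply IsUnit.map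
      rw [PowerSeries.isUnit_iff_constantCoeff, ev, ← Polynomial.derivative_map, h]
      simp [hc])
  refine ⟨y, ?_, hy⟩
  rw [hI, map_sub, sub_eq_zero, PowerSeries.constantCoeff_C] at hy'
  rw [PowerSeries.isUnit_iff_constantCoeff, hy']
  simp [hc]

/-- A monic polynomial over `K⟦X⟧` whose Newton polygon has the slopes `a + 1, a + 3, …`, each
of length one, splits. -/
theorem exists_eq_prod_of_coeff_eq {K : Type*} [Field K] (N : ℕ) :
    ∀ (a : ℕ) (p : Polynomial K⟦X⟧), p.Monic → p.natDegree = N →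
      (∀ i j, i + j = N → ∃ u : K⟦X⟧, IsUnit u ∧ p.coeff i = PowerSeries.X ^ (j ^ 2 + a * j) * u) →
      ∃ lam : Fin N → K⟦X⟧, p = ∏ k, (Polynomial.X - Polynomial.C (lam k)) ∧
        ∀ k : Fin N, PowerSeries.X ^ (a + 2 * (k : ℕ) + 1) ∣ lam k := by
  induction N with
  | zero =>
    intro a p hp hd _
    exact ⟨Fin.elim0, by simpa using hp.natDegree_eq_zero.mp hd, fun k => k.elim0⟩
  | succ M ih =>
    intro a p hp hd h
    choose! u hu hpu using fun i (hi : i ≤ M + 1) => h i (M + 1 - i) (by omega)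
    have hcM : PowerSeries.constantCoeff (u M) ≠ 0 :=
      ((PowerSeries.isUnit_iff_constantCoeff).mp (hu M (by omega))).ne_zero
    have huM : u (M + 1) = 1 := by
      have := hpu (M + 1) le_rfl
      rw [← hd, hp.coeff_natDegree, hd] at this
      simpa using this.symm
    -- Substituting X^(a+1) y into p and dividing by X^((a+1)(M+1)) leaves the exponent j(j-1) on
    -- the coefficient with j = M+1-i. Modulo X only j = 0 and j = 1 survive, which is the shape
    -- Hensel's lemma requires.
    let g : Polynomial K⟦X⟧ := ∑ i ∈ Finset.range (M + 2),
      Polynomial.C (PowerSeries.X ^ ((M + 1 - i) * (M - i)) * u i) * Polynomial.X ^ i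
    have hgc : ∀ i, i ≤ M + 1 → g.coeff i = PowerSeries.X ^ ((M + 1 - i) * (M - i)) * u i := by
      intro i hi
      simp only [g, Polynomial.finsetSum_coeff, Polynomial.coeff_C_mul_X_pow]
      rw [Finset.sum_ite_eq, if_pos (Finset.mem_range.mpr (by omega))]
    have hgd : g.degree ≤ (M + 1 : ℕ) := by
      refine (Polynomial.degree_sum_le _ _).trans (Finset.sup_le fun i hi => ?_)
      refine (Polynomial.degree_C_mul_X_pow_le _ _).trans ?_
      have := Finset.mem_range.mp hi
      exact_mod_cast (by omega : i ≤ M + 1)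
    have hg : g.Monic := Polynomial.monic_of_degree_le (M + 1) hgd (by
      rw [hgc _ le_rfl, huM]; simp)
    have hmap : g.map PowerSeries.constantCoeff =
        Polynomial.X ^ M * (Polynomial.X + Polynomial.C (PowerSeries.constantCoeff (u M))) := by
      simp only [g, Finset.sum_range_succ, Polynomial.map_add, Polynomial.map_sum]
      rw [Finset.sum_eq_zero, huM]
      · simp
        ring
      · intro i hi
        have := Finset.mem_range.mp hi
        have h0 : (M + 1 - i) * (M - i) ≠ 0 := by
          apply mul_ne_zero <;> omega
        rw [Polynomial.map_mul, Polynomial.map_C, map_mul, map_pow,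
          PowerSeries.constantCoeff_X, zero_pow h0, zero_mul, map_zero, zero_mul]
    obtain ⟨y, hy, hroot⟩ := exists_isRoot_of_map_constantCoeff g hg _ hcM hmap
    set r : K⟦X⟧ := PowerSeries.X ^ (a + 1) * y with hr
    have hpr : p.IsRoot r := by
      have e : p.eval r = PowerSeries.X ^ ((a + 1) * (M + 1)) * g.eval y := by
        rw [Polynomial.eval_eq_sum_range, hd, Polynomial.eval_finsetSum, Finset.mul_sum]
        refine Finset.sum_congr rfl fun i hi => ?_
        have hi' := Finset.mem_range.mp hi
        rw [hpu i (by omega)]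
        simp only [Polynomial.eval_mul, Polynomial.eval_C, Polynomial.eval_pow,
          Polynomial.eval_X, hr]
        have key : (M + 1 - i) ^ 2 + a * (M + 1 - i) + (a + 1) * i =
            (a + 1) * (M + 1) + (M + 1 - i) * (M - i) := by
          rcases Nat.lt_succ_iff_lt_or_eq.mp hi' with h | rfl
          · obtain ⟨j, rfl⟩ : ∃ j, M = i + j := ⟨M - i, by omega⟩
            rw [show i + j + 1 - i = j + 1 by omega, show i + j - i = j by omega]
            ring
          · simp
        calc _ = PowerSeries.X ^ ((M + 1 - i) ^ 2 + a * (M + 1 - i) + (a + 1) * i) * u i * y ^ i := by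
              ring
          _ = _ := by rw [key]; ring
      rw [Polynomial.IsRoot, e, hroot.eq_zero, mul_zero]
    obtain ⟨p', hp'⟩ := Polynomial.dvd_iff_isRoot.mpr hpr
    have hmon : p'.Monic := (Polynomial.monic_X_sub_C r).of_mul_monic_left (hp' ▸ hp)
    have hd' : p'.natDegree = M := by
      have := congrArg Polynomial.natDegree hp'
      rw [hd, (Polynomial.monic_X_sub_C r).natDegree_mul hmon, Polynomial.natDegree_X_sub_C] at this
      omega
    -- The quotient by the root of smallest order has the remaining slopes a+3, a+5, …, hence the
    -- same shape with a+2. Its coefficients come from synthetic division upwards from degree 0: in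
    -- r p'_{i+1} = p'_i - p_{i+1} the second term has strictly smaller order.
    have hco : ∀ i j, i + j = M → ∃ v : K⟦X⟧, IsUnit v ∧
        p'.coeff i = PowerSeries.X ^ (j ^ 2 + (a + 2) * j) * v := by
      intro i
      induction i with
      | zero =>
        intro j hj
        obtain rfl : j = M := by omega
        have h0 := hpu 0 (by omega)
        rw [hp', sub_mul, Polynomial.coeff_sub, Polynomial.coeff_X_mul_zero,
          Polynomial.coeff_C_mul, zero_sub] at h0
        obtain ⟨z, hz⟩ := hy
        refine ⟨-(u 0 * ↑z⁻¹), ((hu 0 (by omega)).mul (Units.isUnit _)).neg, ?_⟩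
        have hX : (PowerSeries.X : K⟦X⟧) ^ (a + 1) ≠ 0 := pow_ne_zero _ PowerSeries.X_ne_zero
        apply mul_left_cancel₀ hX
        have : (PowerSeries.X : K⟦X⟧) ^ (a + 1) * p'.coeff 0 = -(-(r * p'.coeff 0) * ↑z⁻¹) := by
          rw [hr, ← hz]
          linear_combination (-PowerSeries.X ^ (a + 1) * p'.coeff 0) * z.mul_inv
        rw [this, h0, Nat.sub_zero]
        ring
      | succ i ihi =>
        intro j hj
        obtain ⟨v, hv, hv'⟩ := ihi (j + 1) (by omega)
        have h0 := hpu (i + 1) (by omega)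
        rw [hp', sub_mul, Polynomial.coeff_sub, Polynomial.coeff_X_mul,
          Polynomial.coeff_C_mul, hv'] at h0
        have e1 : M + 1 - (i + 1) = j + 1 := by omega
        rw [e1] at h0
        obtain ⟨z, hz⟩ := hy
        refine ⟨(PowerSeries.X ^ (2 * (j + 1)) * v - u (i + 1)) * ((z⁻¹ : K⟦X⟧ˣ) : K⟦X⟧), ?_, ?_⟩
        · refine IsUnit.mul ?_ (Units.isUnit _)
          rw [PowerSeries.isUnit_iff_constantCoeff]
          have := (PowerSeries.isUnit_iff_constantCoeff).mp (hu (i + 1) (by omega))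
          simpa using this
        have hX : (PowerSeries.X : K⟦X⟧) ^ (a + 1) ≠ 0 := pow_ne_zero _ PowerSeries.X_ne_zero
        apply mul_left_cancel₀ hX
        rw [hr, ← hz] at h0
        linear_combination (-(↑z⁻¹ : K⟦X⟧)) * h0 -
          (PowerSeries.X ^ (a + 1) * p'.coeff (i + 1)) * z.mul_inv
    obtain ⟨lam, hl, hl'⟩ := ih (a + 2) p' hmon hd' hco
    refine ⟨Fin.cons r lam, ?_, ?_⟩
    · rw [Fin.prod_univ_succ, hp', hl]
      simp
    · refine Fin.cases ?_ fun k => ?_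
      · exact ⟨y, by simp [hr]⟩
      · have := hl' k
        simp only [Fin.cons_succ, Fin.val_succ]
        convert this using 2
        ring

/-! ### Principal minors and exterior powers -/

/-- The sum of the principal minors of size `m`. -/
def sumMinors {R ι : Type*} [CommRing R] [Fintype ι] [DecidableEq ι] (m : ℕ)
    (A : Matrix ι ι R) : R :=
  ∑ s ∈ Finset.univ.powersetCard m,
    (A.submatrix (Subtype.val : s → ι) (Subtype.val : s → ι)).det

theorem sumMinors_eq_coeff {R ι : Type*} [CommRing R] [Fintype ι] [DecidableEq ι] (m : ℕ)
    (A : Matrix ι ι R) :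
    sumMinors m A = ((1 + (Polynomial.X : Polynomial R) • A.map Polynomial.C).det).coeff m :=
  (Matrix.coeff_det_one_add_X_smul_eq_sum_minors A m).symm

theorem sumMinors_reindex {R ι κ : Type*} [CommRing R] [Fintype ι] [DecidableEq ι]
    [Fintype κ] [DecidableEq κ] (e : ι ≃ κ) (m : ℕ) (A : Matrix ι ι R) :
    sumMinors m (A.reindex e e) = sumMinors m A := by
  rw [sumMinors_eq_coeff, sumMinors_eq_coeff, ← Matrix.det_reindex_self e]
  congr 2
  ext i j : 1
  simp [Matrix.one_apply]

/-- This is det(1 + AB) = det(1 + BA) read off coefficientwise. It takes the place of the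
Cauchy–Binet formula below. -/
theorem sumMinors_mul_comm {R ι κ : Type*} [CommRing R] [Fintype ι] [DecidableEq ι]
    [Fintype κ] [DecidableEq κ] (m : ℕ) (A : Matrix ι κ R) (B : Matrix κ ι R) :
    sumMinors m (A * B) = sumMinors m (B * A) := by
  rw [sumMinors_eq_coeff, sumMinors_eq_coeff, Matrix.map_mul, Matrix.map_mul, ← Matrix.smul_mul,
    Matrix.det_one_add_mul_comm, Matrix.mul_smul]

theorem map_sumMinors {R S ι : Type*} [CommRing R] [CommRing S] [Fintype ι] [DecidableEq ι]
    (f : R →+* S) (m : ℕ) (A : Matrix ι ι R) : f (sumMinors m A) = sumMinors m (A.map f) := by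
  simp only [sumMinors, map_sum, RingHom.map_det]
  rfl

/-- The trace of the `m`-th exterior power is the sum of the principal minors of size `m`. -/
theorem traceWedge_eq_sumMinors {R ι : Type*} [CommRing R] [Fintype ι] [DecidableEq ι] (m : ℕ)
    (A : Matrix ι ι R) : traceWedge m A = sumMinors m A := by
  -- The standard basis of the exterior power needs a linearly ordered index type, hence the passage
  -- to `Fin`. Its diagonal matrix entries are the principal minors.
  let e := Fintype.equivFin ι
  let b := (Pi.basisFun R ι).reindex e
  rw [← sumMinors_reindex e, traceWedge, LinearMap.trace_eq_matrix_trace R (b.exteriorPower m),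
    Matrix.trace, sumMinors]
  simp only [Matrix.diag_apply, LinearMap.toMatrix_apply, exteriorPower.basis_repr_apply,
    exteriorPower.basis_apply, exteriorPower.map_apply_ιMulti_family]
  symm
  refine Finset.sum_bij' (fun s hs => ⟨s, by simpa using hs⟩) (fun s _ => s.1)
    (by simp) (fun s _ => by simp) (by simp) (by simp) ?_
  intro s hs
  have hs' : s.card = m := by simpa using hs
  rw [exteriorPower.ιMulti_family, exteriorPower.ιMultiDual_apply_ιMulti, ← Matrix.det_transpose,
    ← Matrix.det_reindex_self (s.orderIsoOfFin hs').symm.toEquiv]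
  congr 1
  ext i j
  simp [b, Set.powersetCard.ofFinEmbEquiv_symm_apply]

/-! ### Lowest-order term of the minors of a sum of rank one matrices -/

/-- Adjoining a new maximum x ≥ |s| adds 2x+1 ≥ 2|s|+1, with equality only when s already fills the
range below x. The strict part isolates the one subset that contributes to q^(m²). -/
theorem card_sq_le_sum_odd (s : Finset ℕ) :
    s.card ^ 2 ≤ ∑ x ∈ s, (2 * x + 1) ∧
      (s ≠ Finset.range s.card → s.card ^ 2 < ∑ x ∈ s, (2 * x + 1)) := by
  induction s using Finset.induction_on_max with
  | empty => simp
  | insert x s hx ih =>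
    have hxs : x ∉ s := fun h => lt_irrefl _ (hx x h)
    have hsub : s ⊆ Finset.range x := fun y hy => Finset.mem_range.mpr (hx y hy)
    have hc : s.card ≤ x := by simpa using Finset.card_le_card hsub
    rw [Finset.card_insert_of_notMem hxs, Finset.sum_insert hxs]
    refine ⟨by nlinarith [ih.1], fun hne => ?_⟩
    rcases hc.lt_or_eq with h | h
    · nlinarith [ih.1]
    · exfalso
      apply hne
      have : s = Finset.range x := Finset.eq_of_subset_of_card_le hsub (by simp [h])
      rw [h, Finset.range_add_one, ← this]

/-- Minors commute with reduction modulo X^k. -/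
theorem X_pow_dvd_sumMinors_sub {K ι : Type*} [Field K] [Fintype ι] [DecidableEq ι] (m k : ℕ)
    (A B : Matrix ι ι K⟦X⟧) (h : ∀ i j, PowerSeries.X ^ k ∣ A i j - B i j) :
    PowerSeries.X ^ k ∣ sumMinors m A - sumMinors m B := by
  rw [← Ideal.mem_span_singleton, ← Ideal.Quotient.eq, map_sumMinors, map_sumMinors]
  congr 1
  ext i j
  simpa [Ideal.Quotient.eq, Ideal.mem_span_singleton] using h i j

theorem sumMinors_diagonal_mul {R ι : Type*} [CommRing R] [Fintype ι] [DecidableEq ι] (m : ℕ)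
    (w : ι → R) (B : Matrix ι ι R) :
    sumMinors m (Matrix.diagonal w * B) = ∑ s ∈ Finset.univ.powersetCard m,
      (∏ i ∈ s, w i) * (B.submatrix (Subtype.val : s → ι) (Subtype.val : s → ι)).det := by
  refine Finset.sum_congr rfl fun s _ => ?_
  rw [← Finset.prod_coe_sort s w, ← Matrix.det_mul_column]
  congr 1
  ext i j
  simp [Matrix.diagonal_mul]

/-- The series `q^d / (1 - q^d)`. -/
def lambertTerm (K : Type*) [Field K] (d : ℕ) : K⟦X⟧ :=
  PowerSeries.mk fun N => if N ≠ 0 ∧ d ∣ N then 1 else 0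

theorem exists_lambertTerm_eq (K : Type*) [Field K] (d : ℕ) (hd : d ≠ 0) :
    ∃ b : K⟦X⟧, lambertTerm K d = PowerSeries.X ^ d * b ∧ PowerSeries.constantCoeff b = 1 := by
  obtain ⟨b, hb⟩ : PowerSeries.X ^ d ∣ lambertTerm K d := by
    rw [PowerSeries.X_pow_dvd_iff]
    intro N hN
    rw [lambertTerm, PowerSeries.coeff_mk, if_neg]
    rintro ⟨h0, h⟩
    exact absurd (Nat.le_of_dvd (Nat.pos_of_ne_zero h0) h) (by omega)
  refine ⟨b, hb, ?_⟩
  have := congrArg (PowerSeries.coeff d) hb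
  rw [lambertTerm, PowerSeries.coeff_mk, if_pos ⟨hd, dvd_rfl⟩, PowerSeries.coeff_X_pow_mul',
    if_pos le_rfl, Nat.sub_self] at this
  simpa using this.symm

/-- The leading term of the sum of the principal minors of size `m` of a matrix of the form
`∑ c_ℓ q^{2ℓ+1}/(1 - q^{2ℓ+1}) v_ℓ v_ℓᵀ`. -/
theorem X_pow_dvd_sumMinors_sub_lead {K ι : Type*} [Field K] [Fintype ι] [DecidableEq ι]
    (c : ℕ → K) (v : ℕ → ι → K) (A : Matrix ι ι K⟦X⟧)
    (hA : ∀ k i j N, N < 2 * k → PowerSeries.coeff N (A i j) = PowerSeries.coeff N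
      (∑ l ∈ Finset.range k, PowerSeries.C (c l * (v l i * v l j)) * lambertTerm K (2 * l + 1)))
    (m : ℕ) :
    PowerSeries.X ^ (m ^ 2 + 1) ∣ sumMinors m A - PowerSeries.X ^ (m ^ 2) *
      PowerSeries.C ((∏ l ∈ Finset.range m, c l) *
        (Matrix.of fun a b : Fin m => v a ⬝ᵥ v b).det) := by
  choose b hb hb1 using fun l : ℕ => exists_lambertTerm_eq K (2 * l + 1) (by omega)
  -- Enough rank one terms to determine all coefficients up to q^(m²), and at least m of them.
  let M := m ^ 2 + 1
  have hmM : m ≤ M := (Nat.le_self_pow two_ne_zero m).trans (Nat.le_succ _)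
  let V : Matrix ι (Fin M) K⟦X⟧ := Matrix.of fun i l => PowerSeries.C (v l i)
  let w : Fin M → K⟦X⟧ := fun l => PowerSeries.X ^ (2 * (l : ℕ) + 1) * (PowerSeries.C (c l) * b l)
  let G : Matrix (Fin M) (Fin M) K := Matrix.of fun a b => v a ⬝ᵥ v b
  have h1 := X_pow_dvd_sumMinors_sub m (m ^ 2 + 1) A (V * (Matrix.diagonal w * Vᵀ)) (by
    intro i j
    rw [PowerSeries.X_pow_dvd_iff]
    intro N hN
    rw [map_sub, hA M i j N (by omega), sub_eq_zero]
    congr 1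
    rw [Finset.sum_range, Matrix.mul_apply]
    refine Finset.sum_congr rfl fun l _ => ?_
    simp only [hb, V, w, Matrix.of_apply, Matrix.diagonal_mul, Matrix.transpose_apply, map_mul]
    ring)
  have hG : Vᵀ * V = G.map PowerSeries.C := by
    ext a b : 2
    simp [V, G, Matrix.mul_apply, dotProduct]
  -- Moving V to the right replaces V diag(w) Vᵀ by diag(w) times the constant Gram matrix, whose
  -- minors split off the weights.
  rw [sumMinors_mul_comm, Matrix.mul_assoc, hG, sumMinors_diagonal_mul] at h1
  let s₀ : Finset (Fin M) := Finset.univ.map (Fin.castLEEmb hmM)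
  have hs₀ : s₀ ∈ Finset.univ.powersetCard m := by simp [s₀]
  rw [← Finset.add_sum_erase _ _ hs₀] at h1
  have h2 : PowerSeries.X ^ (m ^ 2 + 1) ∣ ∑ s ∈ (Finset.univ.powersetCard m).erase s₀,
      (∏ i ∈ s, w i) * ((G.map PowerSeries.C).submatrix
        (Subtype.val : s → Fin M) (Subtype.val : s → Fin M)).det := by
    refine Finset.dvd_sum fun s hs => Dvd.dvd.mul_right ?_ _
    obtain ⟨hne, hs⟩ := Finset.mem_erase.mp hs
    have hcard : s.card = m := by simpa using hs
    have hw : m ^ 2 + 1 ≤ ∑ i ∈ s, (2 * (i : ℕ) + 1) := by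
      have := (card_sq_le_sum_odd (s.map Fin.valEmbedding)).2 (by
        rw [Finset.card_map, hcard]
        intro h
        apply hne
        apply Finset.map_injective Fin.valEmbedding
        rw [h]
        ext x
        simp only [Finset.mem_range, s₀, Finset.mem_map, Finset.mem_univ, true_and,
          exists_exists_eq_and]
        constructor
        · intro hx
          exact ⟨⟨x, hx⟩, rfl⟩
        · rintro ⟨a, rfl⟩
          exact a.2)
      rw [Finset.card_map, hcard, Finset.sum_map] at this
      exact this
    refine (pow_dvd_pow _ hw).trans ?_
    simp only [w, Finset.prod_mul_distrib, Finset.prod_pow_eq_pow_sum]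
    exact Dvd.intro _ rfl
  have hprod : ∏ i ∈ s₀, w i = PowerSeries.X ^ (m ^ 2) *
      ∏ l ∈ Finset.range m, (PowerSeries.C (c l) * b l) := by
    have : ∑ l ∈ Finset.range m, (2 * l + 1) = m ^ 2 := by
      clear * -
      induction m with
      | zero => simp
      | succ m ih => rw [Finset.sum_range_succ, ih]; ring
    rw [← this, ← Finset.prod_pow_eq_pow_sum, ← Finset.prod_mul_distrib, Finset.prod_range]
    simp [s₀, w]
  have hdet : ((G.map PowerSeries.C).submatrix
        (Subtype.val : s₀ → Fin M) (Subtype.val : s₀ → Fin M)).det =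
      PowerSeries.C (Matrix.of fun a b : Fin m => v a ⬝ᵥ v b).det := by
    let e : Fin m ≃ s₀ := Equiv.ofBijective (fun a => ⟨Fin.castLE hmM a, by simp [s₀]⟩)
      ⟨fun a b h => by simpa using h, fun ⟨x, hx⟩ => by
        obtain ⟨a, -, rfl⟩ := Finset.mem_map.mp hx
        exact ⟨a, rfl⟩⟩
    rw [← Matrix.det_submatrix_equiv_self e, RingHom.map_det]
    rfl
  have h3 : PowerSeries.X ^ (m ^ 2 + 1) ∣ (∏ i ∈ s₀, w i) * ((G.map PowerSeries.C).submatrix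
        (Subtype.val : s₀ → Fin M) (Subtype.val : s₀ → Fin M)).det -
      PowerSeries.X ^ (m ^ 2) * PowerSeries.C ((∏ l ∈ Finset.range m, c l) *
        (Matrix.of fun a b : Fin m => v a ⬝ᵥ v b).det) := by
    rw [hprod, hdet, mul_assoc, ← mul_sub, pow_succ]
    refine mul_dvd_mul_left _ ?_
    rw [PowerSeries.X_dvd_iff]
    simp [Finset.prod_mul_distrib, hb1]
  have := dvd_add (dvd_add h1 h2) h3
  convert this using 1
  ring

/-! ### Values η_ℓ(m) and the vectors ξ_ℓ -/

/-- The coefficient `8^k / (2k choose k)`. -/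
def hyperCoeff (k : ℕ) : ℝ := 8 ^ k / (Nat.choose (2 * k) k : ℝ)

theorem hyperCoeff_pos (k : ℕ) : 0 < hyperCoeff k := by
  have := Nat.centralBinom_pos k
  rw [Nat.centralBinom] at this
  unfold hyperCoeff
  positivity

theorem succ_mul_choose_two_mul (k : ℕ) : ((k : ℝ) + 1) * (Nat.choose (2 * (k + 1)) (k + 1) : ℝ) =
    2 * (2 * k + 1) * (Nat.choose (2 * k) k : ℝ) := by
  have := Nat.succ_mul_centralBinom_succ k
  simp only [Nat.centralBinom] at this
  exact_mod_cast this

theorem hyperCoeff_succ (k : ℕ) :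
    (2 * k + 1) * hyperCoeff (k + 1) = 4 * (k + 1) * hyperCoeff k := by
  have h := succ_mul_choose_two_mul k
  have h1 : (0 : ℝ) < Nat.choose (2 * k) k := by exact_mod_cast Nat.centralBinom_pos k
  have h2 : (0 : ℝ) < Nat.choose (2 * (k + 1)) (k + 1) := by
    exact_mod_cast Nat.centralBinom_pos (k + 1)
  unfold hyperCoeff
  rw [mul_div_assoc', mul_div_assoc', div_eq_div_iff h2.ne' h1.ne', pow_succ]
  linear_combination (-4) * 8 ^ k * h

theorem pPoly_eq (l m : ℕ) : pPoly l m =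
    ∑ k ∈ Finset.range (l + 1), hyperCoeff k * (Nat.choose m k : ℝ) * (Nat.choose l k : ℝ) := by
  refine Finset.sum_congr rfl fun k _ => ?_
  rw [hyperCoeff, pow_mul]
  norm_num
  ring

/-- The binomials cut the sum off at min(l, m), so p is symmetric in l and m. It can therefore be
read as a polynomial in either variable. -/
theorem pPoly_eq' (l m : ℕ) : pPoly l m =
    ∑ k ∈ Finset.range (m + 1), hyperCoeff k * (Nat.choose m k : ℝ) * (Nat.choose l k : ℝ) := by
  rw [pPoly_eq]
  have aux : ∀ a b : ℕ, ∀ f : ℕ → ℝ, (∀ k, a < k → f k = 0) →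
      ∑ k ∈ Finset.range (a + 1), f k = ∑ k ∈ Finset.range (a + b + 1), f k := fun a b f h =>
    Finset.sum_subset (by simp) fun k _ hk => h k (by simpa using hk)
  rw [aux l m _ fun k hk => by simp [Nat.choose_eq_zero_of_lt hk],
    aux m l _ fun k hk => by simp [Nat.choose_eq_zero_of_lt hk], add_comm l m]

theorem pPoly_pos (l m : ℕ) : 0 < pPoly l m := by
  rw [pPoly_eq]
  refine Finset.sum_pos' (fun k _ => ?_) ⟨0, by simp, by simp [hyperCoeff_pos]⟩
  have := hyperCoeff_pos k
  positivity

theorem prod_sub_eq_descFactorial (l k : ℕ) :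
    ∏ j ∈ Finset.range k, ((j : ℂ) - l) = (-1) ^ k * ((l.descFactorial k : ℕ) : ℂ) := by
  induction k with
  | zero => simp
  | succ k ih =>
    rw [Finset.prod_range_succ, ih, Nat.descFactorial_succ]
    rcases le_or_gt k l with h | h
    · push_cast [h]; ring
    · simp [Nat.descFactorial_of_lt h]

/-- The real value of `η_ℓ(m)`. -/
theorem eta_eq (l m : ℕ) :
    eta l m = (((2 ^ m)⁻¹ * √(Nat.choose (2 * m) m : ℝ) * pPoly l m : ℝ) : ℂ) := by
  have hm : (m.factorial : ℝ) ≠ 0 := by positivity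
  have hs : √(((2 * m).factorial : ℕ) : ℝ) = √(Nat.choose (2 * m) m : ℝ) * m.factorial := by
    rw [← Real.sqrt_sq (show (0 : ℝ) ≤ m.factorial by positivity), ← Real.sqrt_mul (by positivity)]
    congr 1
    have := Nat.choose_mul_factorial_mul_factorial (show m ≤ 2 * m by omega)
    rw [show 2 * m - m = m by omega] at this
    rw [sq, ← mul_assoc]
    exact_mod_cast this.symm
  rw [eta, orthoPoly, hs, pPoly_eq']
  push_cast
  rw [Finset.mul_sum, Finset.mul_sum]
  refine Finset.sum_congr rfl fun k hk => ?_
  have hk : k ≤ m := Nat.lt_succ_iff.mp (Finset.mem_range.mp hk)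
  -- At the point -i(1/2+2ℓ) each factor collapses to j - ℓ, so the product is a signed falling
  -- factorial.
  have e1 : ∀ j ∈ Finset.range k,
      ((j : ℂ) - Complex.I * (-Complex.I * (1 / 2 + 2 * (l : ℂ))) / 2 + 1 / 4) = (j : ℂ) - l := by
    intro j _
    linear_combination (1 / 4 + (l : ℂ)) * Complex.I_mul_I
  rw [Finset.prod_congr rfl e1, prod_sub_eq_descFactorial, Nat.descFactorial_eq_factorial_mul_choose]
  have e2 : (2 : ℂ) ^ (3 * (k : ℤ) - (m : ℤ)) = 8 ^ k * (2 ^ m)⁻¹ := by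
    rw [zpow_sub₀ two_ne_zero, zpow_mul]
    norm_num
    rfl
  have e3 : (Nat.choose m k : ℂ) * k.factorial * (m - k).factorial = m.factorial := by
    exact_mod_cast Nat.choose_mul_factorial_mul_factorial hk
  have e4 : (Nat.choose (2 * k) k : ℂ) * k.factorial * k.factorial = (2 * k).factorial := by
    have := Nat.choose_mul_factorial_mul_factorial (show k ≤ 2 * k by omega)
    rw [show 2 * k - k = k by omega] at this
    exact_mod_cast this
  have n1 : (k.factorial : ℂ) ≠ 0 := by exact_mod_cast k.factorial_ne_zero
  have n2 : ((m - k).factorial : ℂ) ≠ 0 := by exact_mod_cast (m - k).factorial_ne_zero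
  have n3 : (Nat.choose (2 * k) k : ℂ) ≠ 0 := by exact_mod_cast (Nat.centralBinom_pos k).ne'
  have n4 : (2 : ℂ) ^ m ≠ 0 := pow_ne_zero _ two_ne_zero
  rw [e2, ← e3, ← e4, hyperCoeff]
  push_cast
  have n5 : ((-1 : ℂ) ^ k) * (-1) ^ k = 1 := by rw [← mul_pow]; simp
  field_simp
  linear_combination ((√(Nat.choose (2 * m) m : ℝ) : ℂ) * (Nat.choose m k : ℂ) * (Nat.choose l k : ℂ)) * n5

/-- Thus ξ_ℓ is η_ℓ scaled by a factor whose square is |α_ℓ|. Positivity of p removes the absolute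
value from √(p²). -/
theorem xi_eq (n : ℕ) (s : ℤˣ) (l : ℕ) (i : ParityIndex n s) :
    xi n s l i = ((2 ^ l)⁻¹ * √(Nat.choose (2 * l) l : ℝ)) *
      ((2 ^ (i.1 : ℕ))⁻¹ * √(Nat.choose (2 * (i.1 : ℕ)) i.1 : ℝ) * pPoly l i.1) := by
  rw [xi, sigmaCoeff, Real.sqrt_mul (by positivity), Real.sqrt_mul (by positivity),
    Real.sqrt_sq (pPoly_pos _ _).le, pow_add, mul_inv]
  ring

/-! ### Nonvanishing of the Gram determinants -/

/-- `p_ℓ` as a polynomial of degree `ℓ`. -/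
def pPolynomial (l : ℕ) : Polynomial ℝ :=
  ∑ k ∈ Finset.range (l + 1),
    Polynomial.C (hyperCoeff k * (Nat.choose l k : ℝ) / k.factorial) * descPochhammer ℝ k

theorem eval_pPolynomial (l m : ℕ) : (pPolynomial l).eval (m : ℝ) = pPoly l m := by
  rw [pPolynomial, Polynomial.eval_finsetSum, pPoly_eq]
  refine Finset.sum_congr rfl fun k _ => ?_
  rw [Polynomial.eval_mul, Polynomial.eval_C, descPochhammer_eval_eq_descFactorial,
    Nat.descFactorial_eq_factorial_mul_choose]
  have : (k.factorial : ℝ) ≠ 0 := by positivity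
  push_cast
  field_simp

theorem degree_pPolynomial (l : ℕ) : (pPolynomial l).degree = l := by
  have hd : ∀ (k : ℕ) (c : ℝ), c ≠ 0 → (Polynomial.C c * descPochhammer ℝ k).degree = (k : WithBot ℕ) := by
    intro k c hc
    rw [Polynomial.degree_C_mul hc, Polynomial.degree_eq_natDegree (monic_descPochhammer ℝ k).ne_zero,
      descPochhammer_natDegree]
  have hl : hyperCoeff l * (Nat.choose l l : ℝ) / l.factorial ≠ 0 := by
    have := hyperCoeff_pos l
    rw [Nat.choose_self]
    positivity
  rw [pPolynomial, Finset.sum_range_succ, Polynomial.degree_add_eq_right_of_degree_lt, hd l _ hl]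
  rw [hd l _ hl]
  refine (Polynomial.degree_sum_le _ _).trans_lt ((Finset.sup_lt_iff (WithBot.bot_lt_coe l)).mpr ?_)
  intro k hk
  have hk := Finset.mem_range.mp hk
  rw [hd k]
  · exact WithBot.coe_lt_coe.mpr hk
  · have := hyperCoeff_pos k
    have := Nat.choose_pos hk.le
    positivity

/-- A vanishing Gram determinant gives a linear relation among the ξ_ℓ. Up to a positive factor in
each coordinate it says that a combination of p_0, …, p_{m-1}, of degree below m, vanishes at N ≥ m
distinct integers. Such a combination is zero, and the p_ℓ are independent because their degrees are
distinct. -/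
theorem gramDet_ne_zero (n : ℕ) (s : ℤˣ) (m : ℕ)
    (hm : m ≤ Fintype.card (ParityIndex n s)) : gramDet n s m ≠ 0 := by
  intro h0
  rw [gramDet] at h0
  let Y : Matrix (Fin m) (ParityIndex n s) ℝ := Matrix.of fun a i => xi n s a i
  have hY : (Matrix.of fun a b : Fin m => xi n s a ⬝ᵥ xi n s b) = Y * Yᵀ := rfl
  rw [hY] at h0
  obtain ⟨v, hv, hv0⟩ := Matrix.exists_vecMul_eq_zero_iff.mpr h0
  have h1 : v ᵥ* Y = 0 := by
    rw [← dotProduct_self_eq_zero]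
    have : (v ᵥ* (Y * Yᵀ)) ⬝ᵥ v = 0 := by rw [hv0, zero_dotProduct]
    rwa [← Matrix.vecMul_vecMul, ← Matrix.dotProduct_mulVec, Matrix.mulVec_transpose] at this
  let S : Polynomial.Sequence ℝ := ⟨pPolynomial, degree_pPolynomial⟩
  have hli := S.linearIndependent
  let r : Fin m → ℝ := fun a => v a * ((2 ^ (a : ℕ))⁻¹ * √(Nat.choose (2 * (a : ℕ)) a : ℝ))
  let p : Polynomial ℝ := ∑ a : Fin m, r a • pPolynomial a
  have hp : p = 0 := by
    refine Polynomial.eq_zero_of_natDegree_lt_card_of_eval_eq_zero' p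
      (Finset.univ.map ⟨fun i : ParityIndex n s => ((i.1 : ℕ) : ℝ), fun i j h => ?_⟩) ?_ ?_
    · exact Subtype.ext (Fin.ext (Nat.cast_injective (R := ℝ) h))
    · intro x hx
      obtain ⟨i, -, rfl⟩ := Finset.mem_map.mp hx
      have := congrFun h1 i
      simp only [Matrix.vecMul, dotProduct, Y, Matrix.of_apply, xi_eq, Pi.zero_apply] at this
      have hpos : (0 : ℝ) < (2 ^ (i.1 : ℕ))⁻¹ * √(Nat.choose (2 * (i.1 : ℕ)) i.1 : ℝ) := by
        have : 0 < Nat.choose (2 * (i.1 : ℕ)) i.1 := Nat.centralBinom_pos _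
        positivity
      refine (mul_eq_zero.mp (?_ : _ * _ = (0 : ℝ))).resolve_left hpos.ne'
      rw [← this]
      change _ * p.eval ((i.1 : ℕ) : ℝ) = _
      simp only [p, Polynomial.eval_finsetSum, Polynomial.eval_smul, smul_eq_mul, r,
        eval_pPolynomial, Finset.mul_sum]
      refine Finset.sum_congr rfl fun a _ => ?_
      ring
    · rcases Nat.eq_zero_or_pos m with rfl | hm0
      · exact absurd (Subsingleton.elim v 0) hv
      rw [Finset.card_map, Finset.card_univ]
      refine lt_of_lt_of_le ?_ hm
      refine lt_of_le_of_lt (Polynomial.natDegree_sum_le_of_forall_le (n := m - 1) _ _ ?_) (by omega)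
      intro a _
      refine (Polynomial.natDegree_smul_le _ _).trans ?_
      rw [Polynomial.natDegree_eq_of_degree_eq_some (degree_pPolynomial a)]
      omega
  have := Fintype.linearIndependent_iff.mp (hli.comp (Fin.val : Fin m → ℕ) Fin.val_injective) r hp
  apply hv
  ext a
  have ha := this a
  have : 0 < Nat.choose (2 * (a : ℕ)) a := Nat.centralBinom_pos _
  have hpos : (0 : ℝ) < (2 ^ (a : ℕ))⁻¹ * √(Nat.choose (2 * (a : ℕ)) a : ℝ) := by positivity
  exact (mul_eq_zero.mp ha).resolve_right hpos.ne'

/-! ### Meixner polynomials: recurrence, parity, orthogonality -/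

open Polynomial in
/-- The binomial coefficient `(θ choose k)` as a polynomial in `X = 1/2 + 2θ`. -/
def binomPoly (k : ℕ) : ℝ[X] :=
  C ((k.factorial : ℝ)⁻¹) * ∏ j ∈ Finset.range k, (C (1 / 2) * X - C (1 / 4 + (j : ℝ)))

-- With X = 1/2 + 2θ this is θ (θ choose k) = (k+1) (θ choose k+1) + k (θ choose k).
open Polynomial in
theorem X_mul_binomPoly (k : ℕ) : X * binomPoly k =
    C (2 * ((k : ℝ) + 1)) * binomPoly (k + 1) + C (2 * (k : ℝ) + 1 / 2) * binomPoly k := by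
  have h : C (2 * ((k : ℝ) + 1)) * C (((k + 1).factorial : ℝ)⁻¹) =
      (C (2 * (k.factorial : ℝ)⁻¹) : ℝ[X]) := by
    rw [← C_mul, Nat.factorial_succ]
    congr 1
    have : (k.factorial : ℝ) ≠ 0 := by positivity
    push_cast
    field_simp
  rw [binomPoly, binomPoly, Finset.prod_range_succ, ← mul_assoc (C (2 * ((k : ℝ) + 1))), h]
  have h2 : (C (1 / 2) : ℝ[X]) * 2 = 1 := by
    rw [show (2 : ℝ[X]) = C 2 from rfl, ← C_mul]
    norm_num
  have h4 : (C (1 / 4) : ℝ[X]) * 2 = C (1 / 2) := by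
    rw [show (2 : ℝ[X]) = C 2 from rfl, ← C_mul]
    norm_num
  simp only [C_mul, C_add, show (C (2 : ℝ) : ℝ[X]) = 2 from rfl]
  linear_combination (-X * h2 + h4) * (C ((k.factorial : ℝ)⁻¹) *
    ∏ j ∈ Finset.range k, (C (1 / 2) * X - (C (1 / 4) + C (j : ℝ))))

theorem natDegree_binomPoly_le (k : ℕ) : (binomPoly k).natDegree ≤ k := by
  refine (Polynomial.natDegree_C_mul_le _ _).trans ?_
  refine (Polynomial.natDegree_prod_le _ _).trans ?_
  refine (Finset.sum_le_card_nsmul _ _ 1 fun j _ => ?_).trans (by simp)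
  rw [Polynomial.natDegree_sub_C]
  exact (Polynomial.natDegree_C_mul_le _ _).trans Polynomial.natDegree_X_le

theorem eval_binomPoly (k l : ℕ) :
    (binomPoly k).eval (1 / 2 + 2 * (l : ℝ)) = (Nat.choose l k : ℝ) := by
  have h : ∀ k, ∏ j ∈ Finset.range k, ((l : ℝ) - j) = ((l.descFactorial k : ℕ) : ℝ) := by
    intro k
    rw [← descPochhammer_eval_eq_descFactorial, descPochhammer_eval_eq_prod_range]
  rw [binomPoly, Polynomial.eval_mul, Polynomial.eval_C, Polynomial.eval_prod]
  have : ∀ j ∈ Finset.range k, Polynomial.eval (1 / 2 + 2 * (l : ℝ))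
      (Polynomial.C (1 / 2) * Polynomial.X - Polynomial.C (1 / 4 + (j : ℝ))) = (l : ℝ) - j := by
    intro j _
    simp
    ring
  rw [Finset.prod_congr rfl this, h, Nat.descFactorial_eq_factorial_mul_choose]
  have : (k.factorial : ℝ) ≠ 0 := by positivity
  push_cast
  field_simp

open Polynomial in
/-- The Meixner polynomial `₂F₁(-m, -θ; 1/2; 2)` as a polynomial in `X = 1/2 + 2θ`. -/
def meixner (m : ℕ) : ℝ[X] :=
  ∑ k ∈ Finset.range (m + 1), C (hyperCoeff k * (Nat.choose m k : ℝ)) * binomPoly k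

theorem meixner_eq (m K : ℕ) (h : m < K) : meixner m =
    ∑ k ∈ Finset.range K, Polynomial.C (hyperCoeff k * (Nat.choose m k : ℝ)) * binomPoly k := by
  refine Finset.sum_subset (by simpa using h) fun k _ hk => ?_
  rw [Nat.choose_eq_zero_of_lt (by simpa using hk)]
  simp

theorem meixner_zero : meixner 0 = 1 := by
  simp [meixner, hyperCoeff, binomPoly]

theorem natDegree_meixner_le (m : ℕ) : (meixner m).natDegree ≤ m := by
  refine Polynomial.natDegree_sum_le_of_forall_le _ _ fun k hk => ?_
  refine (Polynomial.natDegree_C_mul_le _ _).trans ((natDegree_binomPoly_le k).trans ?_)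
  exact Nat.lt_succ_iff.mp (Finset.mem_range.mp hk)

theorem eval_meixner (m l : ℕ) : (meixner m).eval (1 / 2 + 2 * (l : ℝ)) = pPoly l m := by
  rw [meixner, Polynomial.eval_finsetSum, pPoly_eq']
  simp only [Polynomial.eval_mul, Polynomial.eval_C, eval_binomPoly]

-- Comparison of coefficients in the binomial basis reduces this to Pascal's rule and
-- `hyperCoeff_succ`. At m = 0 the truncated index m - 1 is harmless because its coefficient is
-- zero. The absence of a multiple of `meixner m` on the right is what gives the parity.
open Polynomial in
theorem X_mul_meixner (m : ℕ) : X * meixner m =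
    C ((m : ℝ) + 1 / 2) * meixner (m + 1) - C (m : ℝ) * meixner (m - 1) := by
  rw [meixner_eq m (m + 2) (by omega), meixner_eq (m + 1) (m + 3) (by omega),
    meixner_eq (m - 1) (m + 3) (by omega), Finset.mul_sum, Finset.mul_sum, Finset.mul_sum,
    ← Finset.sum_sub_distrib]
  have hm : ∀ k : ℕ, (m : ℝ) * (Nat.choose (m - 1) k : ℝ) = (m - k) * (Nat.choose m k : ℝ) := by
    intro k
    rcases m with _ | m
    · rcases k with _ | k <;> simp
    · rcases le_or_gt k (m + 1) with h | h
      · have := Nat.choose_mul_succ_eq m k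
        have h2 : (Nat.choose m k : ℝ) * (m + 1) = Nat.choose (m + 1) k * ((m + 1 : ℕ) - k : ℝ) := by
          rw [← Nat.cast_sub h]
          exact_mod_cast this
        rw [Nat.add_sub_cancel]
        push_cast at h2 ⊢
        linarith
      · rw [Nat.choose_eq_zero_of_lt h, Nat.choose_eq_zero_of_lt (by omega)]
        simp
  have e1 : ∀ k, X * (C (hyperCoeff k * (Nat.choose m k : ℝ)) * binomPoly k) =
      C (hyperCoeff k * (Nat.choose m k : ℝ) * (2 * ((k : ℝ) + 1))) * binomPoly (k + 1) +
      C (hyperCoeff k * (Nat.choose m k : ℝ) * (2 * (k : ℝ) + 1 / 2)) * binomPoly k := by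
    intro k
    rw [mul_left_comm, X_mul_binomPoly, C_mul (a := hyperCoeff k * (Nat.choose m k : ℝ)),
      C_mul (a := hyperCoeff k * (Nat.choose m k : ℝ))]
    ring
  simp only [e1, Finset.sum_add_distrib]
  have e2 : ∑ k ∈ Finset.range (m + 2),
      C (hyperCoeff k * (Nat.choose m k : ℝ) * (2 * (k : ℝ) + 1 / 2)) * binomPoly k =
      ∑ k ∈ Finset.range (m + 3),
      C (hyperCoeff k * (Nat.choose m k : ℝ) * (2 * (k : ℝ) + 1 / 2)) * binomPoly k := by
    rw [Finset.sum_range_succ _ (m + 2), Nat.choose_eq_zero_of_lt (by omega)]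
    simp
  rw [e2, ← eq_sub_iff_add_eq, ← Finset.sum_sub_distrib, Finset.sum_range_succ' _ (m + 2)]
  have e3 : ∀ k, C ((m : ℝ) + 1 / 2) * (C (hyperCoeff k * (Nat.choose (m + 1) k : ℝ)) * binomPoly k)
      - C (m : ℝ) * (C (hyperCoeff k * (Nat.choose (m - 1) k : ℝ)) * binomPoly k)
      - C (hyperCoeff k * (Nat.choose m k : ℝ) * (2 * (k : ℝ) + 1 / 2)) * binomPoly k =
      C (hyperCoeff k * ((m + 1 / 2) * (Nat.choose (m + 1) k : ℝ)
        - (m * (Nat.choose (m - 1) k : ℝ)) - (2 * k + 1 / 2) * (Nat.choose m k : ℝ))) *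
        binomPoly k := by
    intro k
    simp only [C_mul, C_sub, C_add]
    ring
  simp only [e3]
  have e4 : (m + 1 / 2) * (Nat.choose (m + 1) 0 : ℝ) - (m * (Nat.choose (m - 1) 0 : ℝ)) -
      (2 * (0 : ℕ) + 1 / 2) * (Nat.choose m 0 : ℝ) = 0 := by simp
  rw [e4, mul_zero, C_0, zero_mul, add_zero]
  refine Finset.sum_congr rfl fun k _ => ?_
  congr 2
  rw [hm, Nat.choose_succ_succ' m k]
  have h1 : (Nat.choose m (k + 1) : ℝ) * (k + 1) = Nat.choose m k * (m - k) := by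
    rcases le_or_gt k m with h | h
    · rw [← Nat.cast_sub h]
      exact_mod_cast Nat.choose_succ_right_eq m k
    · rw [Nat.choose_eq_zero_of_lt h, Nat.choose_eq_zero_of_lt (by omega)]
      simp
  have h2 := hyperCoeff_succ k
  push_cast
  linear_combination hyperCoeff (k + 1) * h1 - (Nat.choose m k : ℝ) / 2 * h2

theorem eval_neg_meixner (m : ℕ) (y : ℝ) :
    (meixner m).eval (-y) = (-1) ^ m * (meixner m).eval y := by
  induction m using Nat.strong_induction_on with
  | _ m ih =>
    rcases m with _ | m
    · simp [meixner_zero]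
    have h := X_mul_meixner m
    have h1 := congrArg (Polynomial.eval y) h
    have h2 := congrArg (Polynomial.eval (-y)) h
    simp only [Polynomial.eval_mul, Polynomial.eval_X, Polynomial.eval_sub, Polynomial.eval_C]
      at h1 h2
    rw [ih m (by omega)] at h2
    have hm : (m : ℝ) + 1 / 2 ≠ 0 := by positivity
    apply mul_left_cancel₀ hm
    rcases m with _ | m
    · simp at h1 h2 ⊢
      linarith
    · rw [Nat.add_sub_cancel] at h1 h2
      rw [ih m (by omega)] at h2
      linear_combination -h2 + (-1) ^ m * h1

/-- Orthogonality of the Meixner polynomials with respect to a functional that vanishes on all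
of them but the first. -/
theorem map_meixner_mul_meixner (F : Polynomial ℝ →ₗ[ℝ] ℝ) (a : ℝ) (h0 : F 1 = a)
    (hF : ∀ m, m ≠ 0 → F (meixner m) = 0) (k m : ℕ) :
    F (meixner m * meixner k) =
      if m = k then (-4) ^ k / (Nat.choose (2 * k) k : ℝ) * a else 0 := by
  induction k using Nat.strong_induction_on generalizing m with
  | _ k ih =>
    rcases k with _ | k
    · rw [meixner_zero, mul_one]
      split_ifs with h
      · simp [h, meixner_zero, h0]
      · exact hF m h
    -- Moving X from one factor to the other and applying the recurrence on both sides expresses the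
    -- pairing with `meixner (k + 1)` through those with `meixner k` and `meixner (k - 1)`.
    have e : meixner m * (Polynomial.X * meixner k) = (Polynomial.X * meixner m) * meixner k := by
      ring
    rw [X_mul_meixner, X_mul_meixner, mul_sub, sub_mul, mul_left_comm, mul_left_comm (meixner m),
      mul_assoc, mul_assoc] at e
    simp only [← Polynomial.smul_eq_C_mul] at e
    have e' := congrArg F e
    simp only [map_sub, map_smul, smul_eq_mul] at e'
    rw [ih k (by omega), ih k (by omega)] at e'
    have hk : (k : ℝ) + 1 / 2 ≠ 0 := by positivity
    apply mul_left_cancel₀ hk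
    rw [sub_eq_iff_eq_add.mp e']
    have h3 : (k : ℝ) * F (meixner m * meixner (k - 1)) =
        if m + 1 = k then (k : ℝ) * ((-4) ^ (k - 1) / (Nat.choose (2 * (k - 1)) (k - 1) : ℝ) * a)
        else 0 := by
      rcases k with _ | k
      · simp
      · rw [Nat.add_sub_cancel, ih k (by omega)]
        simp
    rw [h3]
    have hc := succ_mul_choose_two_mul
    have hpos : ∀ k : ℕ, (Nat.choose (2 * k) k : ℝ) ≠ 0 := fun k => by
      exact_mod_cast (Nat.centralBinom_pos k).ne'
    by_cases h1 : m + 1 = k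
    · subst h1
      rw [if_pos rfl, if_neg (by omega), if_pos rfl, if_neg (by omega), Nat.add_sub_cancel]
      have := hc m
      have p1 := hpos m
      have p2 := hpos (m + 1)
      field_simp
      push_cast
      rw [pow_succ]
      linear_combination (2 * (-4) ^ m * a) * this
    · rw [if_neg h1, if_neg h1]
      rcases m with _ | m
      · simp
      · rw [Nat.add_sub_cancel]
        by_cases h2 : m = k
        · subst h2
          rw [if_pos rfl, if_pos rfl]
          have := hc m
          have p1 := hpos m
          have p2 := hpos (m + 1)
          field_simp
          push_cast
          rw [pow_succ]
          linear_combination (-2 * (-4) ^ m * a) * this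
        · rw [if_neg h2, if_neg (by omega)]
          simp

/-! ### The archimedean functional -/

/-- The function `(e^{-x} + e^x)^{-1/2}`. -/
def archFun (x : ℝ) : ℝ := 1 / √(Real.exp (-x) + Real.exp x)

/-- The function `e^{2x} / (1 + e^{2x})`. -/
def logistic (x : ℝ) : ℝ := Real.exp (2 * x) / (1 + Real.exp (2 * x))

theorem hasDerivAt_logistic (x : ℝ) :
    HasDerivAt logistic (2 * logistic x * (1 - logistic x)) x := by
  have h1 : HasDerivAt (fun x : ℝ => Real.exp (2 * x)) (Real.exp (2 * x) * 2) x := by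
    simpa using ((hasDerivAt_id x).const_mul 2).exp
  have hp : 1 + Real.exp (2 * x) ≠ 0 := by positivity
  have := h1.div (h1.const_add 1) hp
  refine this.congr_deriv ?_
  rw [logistic]
  field_simp

theorem hasDerivAt_archFun (x : ℝ) :
    HasDerivAt archFun (archFun x * (1 / 2 - logistic x)) x := by
  have h1 : HasDerivAt (fun x : ℝ => Real.exp (-x) + Real.exp x) (-Real.exp (-x) + Real.exp x) x := by
    have h0 : HasDerivAt (fun x : ℝ => Real.exp (-x)) (-Real.exp (-x)) x := by
      simpa using (hasDerivAt_neg x).exp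
    exact h0.add (Real.hasDerivAt_exp x)
  have hp : 0 < Real.exp (-x) + Real.exp x := by positivity
  have hs : √(Real.exp (-x) + Real.exp x) ≠ 0 := (Real.sqrt_pos.mpr hp).ne'
  have h2 := (h1.sqrt hp.ne').inv hs
  have e : archFun = (fun x : ℝ => √(Real.exp (-x) + Real.exp x))⁻¹ := by
    ext y
    simp [archFun]
  rw [e]
  refine h2.congr_deriv ?_
  rw [Real.sq_sqrt hp.le]
  have e2 : Real.exp (2 * x) = Real.exp x * Real.exp x := by rw [← Real.exp_add]; ring_nf
  have e3 : Real.exp (-x) * Real.exp x = 1 := by rw [← Real.exp_add]; simp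
  have e4 : logistic x = Real.exp x / (Real.exp (-x) + Real.exp x) := by
    rw [logistic, e2, div_eq_div_iff (by positivity) hp.ne']
    linear_combination (Real.exp x) * e3
  rw [e4]
  simp only [Pi.inv_apply]
  field_simp
  ring

theorem contDiff_archFun : ContDiff ℝ (⊤ : ℕ∞) archFun := by
  unfold archFun
  refine ContDiff.div contDiff_const (ContDiff.sqrt (by fun_prop) fun x => by positivity)
    fun x => by positivity

theorem contDiff_logistic : ContDiff ℝ (⊤ : ℕ∞) logistic := by
  unfold logistic
  exact ContDiff.div (by fun_prop) (by fun_prop) fun x => by positivity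

/-- The functions `∏_{j<k} ((∂ - 1/2)/2 - j) (e^{-x} + e^x)^{-1/2}`. -/
def archFunSeq (k : ℕ) (x : ℝ) : ℝ :=
  (∏ j ∈ Finset.range k, -((j : ℝ) + 1 / 2)) * (archFun x * logistic x ^ k)

theorem contDiff_archFunSeq (k : ℕ) : ContDiff ℝ (⊤ : ℕ∞) (archFunSeq k) := by
  have h1 := contDiff_archFun
  have h2 := contDiff_logistic
  unfold archFunSeq
  fun_prop

/-- With L the logistic function, g' = g(1/2 - L) and L' = 2L(1 - L). The shift 1/4 + k is the one
that cancels the g L^k term of (g L^k)'/2, leaving -(k+1/2) g L^(k+1). -/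
theorem archFunSeq_succ (k : ℕ) :
    archFunSeq (k + 1) =
      fun x => (1 / 2) * deriv (archFunSeq k) x - (1 / 4 + (k : ℝ)) * archFunSeq k x := by
  ext x
  have h := ((hasDerivAt_archFun x).mul ((hasDerivAt_logistic x).pow k)).const_mul
    (∏ j ∈ Finset.range k, -((j : ℝ) + 1 / 2))
  have e : deriv (archFunSeq k) x = _ := h.deriv
  rw [e, archFunSeq, archFunSeq, Finset.prod_range_succ]
  rcases k with _ | k
  · simp
    ring
  · simp only [Nat.add_sub_cancel, Pi.pow_apply]
    push_cast
    ring

/-- The functional `p ↦ (p(∂) g)(0)`. -/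
def derivFunctional (g : ℝ → ℝ) : Polynomial ℝ →ₗ[ℝ] ℝ :=
  Polynomial.lsum fun j => LinearMap.id.smulRight (iteratedDeriv j g 0)

open Polynomial in
theorem derivFunctional_C_mul_X_pow (g : ℝ → ℝ) (a : ℝ) (j : ℕ) :
    derivFunctional g (C a * X ^ j) = a * iteratedDeriv j g 0 := by
  rw [C_mul_X_pow_eq_monomial]
  simp [derivFunctional, Polynomial.lsum_apply]

open Polynomial in
theorem derivFunctional_mul (k : ℕ) (p : ℝ[X]) :
    derivFunctional (archFunSeq k) ((C (1 / 2) * X - C (1 / 4 + (k : ℝ))) * p) =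
      derivFunctional (archFunSeq (k + 1)) p := by
  induction p using Polynomial.induction_on' with
  | add p q hp hq => rw [mul_add, map_add (derivFunctional _), map_add (derivFunctional _), hp, hq]
  | monomial j a =>
    rw [← C_mul_X_pow_eq_monomial]
    have e : (C (1 / 2) * X - C (1 / 4 + (k : ℝ))) * (C a * X ^ j) =
        C (1 / 2 * a) * X ^ (j + 1) - C ((1 / 4 + (k : ℝ)) * a) * X ^ j := by
      rw [C_mul, C_mul]
      ring
    have hk := contDiff_archFunSeq k
    have hd : ContDiff ℝ (⊤ : ℕ∞) (deriv (archFunSeq k)) :=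
      (contDiff_infty_iff_deriv.mp hk).2
    rw [e, map_sub, derivFunctional_C_mul_X_pow, derivFunctional_C_mul_X_pow,
      derivFunctional_C_mul_X_pow, archFunSeq_succ, iteratedDeriv_fun_sub, iteratedDeriv_succ']
    · rw [iteratedDeriv_const_mul_field, iteratedDeriv_const_mul_field]
      ring
    · exact (contDiff_const.mul hd).contDiffAt.of_le (by exact_mod_cast le_top)
    · exact (contDiff_const.mul hk).contDiffAt.of_le (by exact_mod_cast le_top)

theorem archFunSeq_zero : archFunSeq 0 = archFun := by
  ext x
  simp [archFunSeq]

/-- The hypergeometric coefficients exactly cancel the values of the binomial polynomials under the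
functional, up to sign and 1/√2. -/
theorem hyperCoeff_mul_prod (k : ℕ) :
    hyperCoeff k * ((k.factorial : ℝ)⁻¹ *
      ((∏ j ∈ Finset.range k, -((j : ℝ) + 1 / 2)) * (1 / 2) ^ k)) = (-1) ^ k := by
  induction k with
  | zero => simp [hyperCoeff]
  | succ k ih =>
    rw [Finset.prod_range_succ, Nat.factorial_succ, pow_succ (-1 : ℝ), ← ih]
    have h := hyperCoeff_succ k
    have h1 : (k.factorial : ℝ) ≠ 0 := by positivity
    rw [pow_succ]
    generalize ∏ j ∈ Finset.range k, -((j : ℝ) + 1 / 2) = P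
    generalize (1 / 2 : ℝ) ^ k = D
    push_cast
    field_simp
    linear_combination (-P * D) * h

-- Each linear factor of the binomial polynomial advances `archFunSeq` by one step. The value at 0
-- then uses g(0) = 1/√2 and L(0) = 1/2.
open Polynomial in
theorem derivFunctional_archFun_binomPoly (k : ℕ) :
    derivFunctional archFun (binomPoly k) = (k.factorial : ℝ)⁻¹ *
      ((∏ j ∈ Finset.range k, -((j : ℝ) + 1 / 2)) * ((√2)⁻¹ * (1 / 2) ^ k)) := by
  have h : ∀ k p, derivFunctional archFun
      ((∏ j ∈ Finset.range k, (C (1 / 2) * X - C (1 / 4 + (j : ℝ)))) * p) =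
      derivFunctional (archFunSeq k) p := by
    intro k
    induction k with
    | zero => simp [archFunSeq_zero]
    | succ k ih =>
      intro p
      rw [Finset.prod_range_succ, mul_assoc, ih, derivFunctional_mul]
  have h1 := derivFunctional_C_mul_X_pow (archFunSeq k) 1 0
  rw [pow_zero, mul_one, one_mul, iteratedDeriv_zero] at h1
  rw [binomPoly, ← smul_eq_C_mul, map_smul, smul_eq_mul, ← mul_one (∏ j ∈ _, _), ← C_1, h, h1]
  simp only [archFunSeq, archFun, logistic]
  norm_num

/-- The sum becomes (1/√2) ∑ (-1)^k (m choose k) = (1 - 1)^m/√2. -/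
theorem derivFunctional_archFun_meixner (m : ℕ) :
    derivFunctional archFun (meixner m) = if m = 0 then (√2)⁻¹ else 0 := by
  have h : ∀ k, hyperCoeff k * (Nat.choose m k : ℝ) * derivFunctional archFun (binomPoly k) =
      (√2)⁻¹ * ((-1) ^ k * (Nat.choose m k : ℝ)) := by
    intro k
    rw [derivFunctional_archFun_binomPoly, ← hyperCoeff_mul_prod]
    ring
  simp only [meixner, map_sum, ← Polynomial.smul_eq_C_mul, map_smul, smul_eq_mul, h,
    ← Finset.mul_sum]
  have := Int.alternating_sum_range_choose (n := m)
  have h2 : ∑ k ∈ Finset.range (m + 1), ((-1) ^ k * (Nat.choose m k : ℝ)) =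
      if m = 0 then 1 else 0 := by exact_mod_cast this
  rw [h2]
  split_ifs <;> simp

theorem iteratedDeriv_archFun_of_odd (j : ℕ) (hj : Odd j) : iteratedDeriv j archFun 0 = 0 := by
  have he : (fun x => archFun (-x)) = archFun := by
    ext x
    simp [archFun, add_comm]
  have := iteratedDeriv_comp_neg j archFun 0
  rw [he, hj.neg_one_pow] at this
  simp at this
  linarith

/-! ### The Hankel matrix in the orthogonal basis -/

open Polynomial in
/-- The functional that gives the `N`-th coefficients of the moment series. -/
def coeffFunctional (N : ℕ) : ℝ[X] →ₗ[ℝ] ℂ :=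
  (if N = 0 then Algebra.linearMap ℝ ℂ ∘ₗ derivFunctional archFun else 0) +
    ∑ d ∈ N.divisors, if Odd d then
      alpha (d / 2) • (Algebra.linearMap ℝ ℂ ∘ₗ (Polynomial.leval (1 / 2 + 2 * ((d / 2 : ℕ) : ℝ)) +
        Polynomial.leval (-(1 / 2 + 2 * ((d / 2 : ℕ) : ℝ))))) else 0

open Polynomial in
theorem coeffFunctional_zero (p : ℝ[X]) :
    coeffFunctional 0 p = (derivFunctional archFun p : ℝ) := by
  simp [coeffFunctional]

open Polynomial in
theorem coeffFunctional_of_ne_zero (N : ℕ) (hN : N ≠ 0) (p : ℝ[X]) :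
    coeffFunctional N p = ∑ d ∈ N.divisors, if Odd d then
      alpha (d / 2) * ((p.eval (1 / 2 + 2 * ((d / 2 : ℕ) : ℝ)) +
        p.eval (-(1 / 2 + 2 * ((d / 2 : ℕ) : ℝ))) : ℝ) : ℂ) else 0 := by
  simp only [coeffFunctional, if_neg hN, zero_add, LinearMap.sum_apply]
  refine Finset.sum_congr rfl fun d _ => ?_
  split_ifs
  · simp [Polynomial.leval_apply]
  · simp

/-- The symmetric pair of points ±(1/2+2ℓ) accounts both for the factor 2 in f_k and for the
vanishing of odd moments; i^j accounts for (-1)^k. -/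
theorem coeff_momentSeries (j N : ℕ) :
    PowerSeries.coeff N (momentSeries j) =
      Complex.I ^ j * coeffFunctional N (Polynomial.X ^ j) := by
  have hF : derivFunctional archFun (Polynomial.X ^ j) = iteratedDeriv j archFun 0 := by
    have := derivFunctional_C_mul_X_pow archFun 1 j
    rwa [Polynomial.C_1, one_mul, one_mul] at this
  rcases Nat.even_or_odd j with he | ho
  · obtain ⟨k, rfl⟩ := he
    rw [← two_mul] at *
    have hI : Complex.I ^ (2 * k) = (-1) ^ k := by rw [pow_mul, Complex.I_sq]
    rw [momentSeries, if_pos ⟨k, two_mul k⟩, Nat.mul_div_cancel_left _ two_pos, hI]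
    have hC : ((-1 : ℂ⟦X⟧)) ^ k = PowerSeries.C ((-1) ^ k) := by simp
    rw [hC, map_add, PowerSeries.coeff_C_mul, PowerSeries.coeff_C]
    by_cases hN : N = 0
    · subst hN
      rw [if_pos rfl, coeffFunctional_zero, hF, archMoment]
      simp only [lambertSeries, PowerSeries.coeff_mk, Nat.divisors_zero, Finset.sum_empty, mul_zero,
        add_zero]
      push_cast
      rfl
    · rw [if_neg hN, zero_add, coeffFunctional_of_ne_zero N hN, lambertSeries, PowerSeries.coeff_mk]
      congr 1
      refine Finset.sum_congr rfl fun d _ => ?_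
      rw [momentFun]
      split_ifs
      · rw [Polynomial.eval_pow, Polynomial.eval_pow, Polynomial.eval_X, Polynomial.eval_X,
          (even_two_mul k).neg_pow]
        push_cast
        ring
      · rfl
  · rw [momentSeries, if_neg (Nat.not_even_iff_odd.mpr ho), map_zero]
    by_cases hN : N = 0
    · subst hN
      rw [coeffFunctional_zero, hF, iteratedDeriv_archFun_of_odd j ho]
      simp
    · rw [coeffFunctional_of_ne_zero N hN, Finset.sum_eq_zero, mul_zero]
      intro d _
      rw [Polynomial.eval_pow, Polynomial.eval_pow, Polynomial.eval_X, Polynomial.eval_X,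
        ho.neg_pow]
      simp

open Polynomial in
/-- The polynomials `P_m(-iX)`. -/
def normMeixner (m : ℕ) : ℝ[X] := C ((2 ^ m)⁻¹ * √(Nat.choose (2 * m) m : ℝ)) * meixner m

theorem natDegree_normMeixner_le (m : ℕ) : (normMeixner m).natDegree ≤ m :=
  (Polynomial.natDegree_C_mul_le _ _).trans (natDegree_meixner_le m)

theorem eval_normMeixner (m l : ℕ) :
    (((normMeixner m).eval (1 / 2 + 2 * (l : ℝ)) : ℝ) : ℂ) = eta l m := by
  rw [normMeixner, Polynomial.eval_mul, Polynomial.eval_C, eval_meixner, eta_eq]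

theorem eval_neg_normMeixner (m : ℕ) (y : ℝ) :
    (normMeixner m).eval (-y) = (-1) ^ m * (normMeixner m).eval y := by
  rw [normMeixner, Polynomial.eval_mul, Polynomial.eval_mul, eval_neg_meixner, Polynomial.eval_C,
    Polynomial.eval_C]
  ring

theorem derivFunctional_normMeixner_mul (m k : ℕ) :
    derivFunctional archFun (normMeixner m * normMeixner k) =
      if m = k then (-1) ^ m * (√2)⁻¹ else 0 := by
  rw [normMeixner, normMeixner, mul_mul_mul_comm, ← Polynomial.C_mul, ← Polynomial.smul_eq_C_mul,
    map_smul, map_meixner_mul_meixner (derivFunctional archFun) (√2)⁻¹]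
  · split_ifs with h
    · subst h
      have h0 : (Nat.choose (2 * m) m : ℝ) ≠ 0 := by exact_mod_cast (Nat.centralBinom_pos m).ne'
      have h1 : √(Nat.choose (2 * m) m : ℝ) * √(Nat.choose (2 * m) m : ℝ) = Nat.choose (2 * m) m :=
        Real.mul_self_sqrt (by positivity)
      have h4 : ((-4 : ℝ)) ^ m = (-1) ^ m * (2 ^ m * 2 ^ m) := by
        rw [← mul_pow, ← mul_pow]
        norm_num
      rw [smul_eq_mul, mul_mul_mul_comm (2 ^ m : ℝ)⁻¹, h1, h4]
      field_simp
    · simp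
  · rw [← meixner_zero, derivFunctional_archFun_meixner, if_pos rfl]
  · intro m hm
    rw [derivFunctional_archFun_meixner, if_neg hm]

/-- The coefficient matrix of the polynomials `P_0, …, P_n`. -/
def orthoMatrix (n : ℕ) : Matrix (Fin (n + 1)) (Fin (n + 1)) ℂ :=
  Matrix.of fun m j => (((normMeixner m).coeff j : ℝ) : ℂ) * (-Complex.I) ^ (j : ℕ)

/-- Congruence by the coefficient matrix is bilinear expansion of G(P_m P_k); the powers of -i in
`orthoMatrix` cancel the i^(i+j) of the moments. -/
theorem orthoMatrix_mul_mul_transpose (n : ℕ) (G : Polynomial ℝ →ₗ[ℝ] ℂ) (m k : Fin (n + 1)) :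
    (orthoMatrix n * (Matrix.of fun i j : Fin (n + 1) =>
      Complex.I ^ ((i : ℕ) + (j : ℕ)) * G (Polynomial.X ^ ((i : ℕ) + (j : ℕ)))) *
      (orthoMatrix n)ᵀ) m k = G (normMeixner m * normMeixner k) := by
  have hR : ∀ m : Fin (n + 1), normMeixner m =
      ∑ j : Fin (n + 1), (normMeixner m).coeff j • Polynomial.X ^ (j : ℕ) := by
    intro m
    conv_lhs => rw [(normMeixner m).as_sum_range' (n + 1)
      ((natDegree_normMeixner_le m).trans_lt m.2)]
    rw [Finset.sum_range]
    simp only [Polynomial.smul_eq_C_mul, Polynomial.C_mul_X_pow_eq_monomial]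
  have hI : ∀ j : ℕ, (-Complex.I) ^ j * Complex.I ^ j = 1 := fun j => by
    rw [← mul_pow, neg_mul, Complex.I_mul_I, neg_neg, one_pow]
  conv_rhs => rw [hR m, hR k, Finset.sum_mul_sum]
  simp only [map_sum, Matrix.mul_apply, Finset.sum_mul, orthoMatrix, Matrix.of_apply,
    Matrix.transpose_apply]
  rw [Finset.sum_comm]
  refine Finset.sum_congr rfl fun i _ => Finset.sum_congr rfl fun j _ => ?_
  rw [smul_mul_smul_comm, ← pow_add, map_smul, Complex.real_smul, pow_add Complex.I]
  push_cast
  linear_combination (((normMeixner m).coeff i : ℝ) : ℂ) * (((normMeixner k).coeff j : ℝ) : ℂ) *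
    G (Polynomial.X ^ ((i : ℕ) + (j : ℕ))) * ((-Complex.I) ^ (j : ℕ) * Complex.I ^ (j : ℕ) * hI i + hI j)

theorem orthoMatrix_mul_hankelZero (n : ℕ) :
    orthoMatrix n * hankelZero n * (orthoMatrix n)ᵀ =
      Matrix.diagonal fun m : Fin (n + 1) => (-1 : ℂ) ^ (m : ℕ) * ((√2 : ℝ) : ℂ)⁻¹ := by
  have h : hankelZero n = Matrix.of fun i j : Fin (n + 1) =>
      Complex.I ^ ((i : ℕ) + (j : ℕ)) *
        coeffFunctional 0 (Polynomial.X ^ ((i : ℕ) + (j : ℕ))) := by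
    ext i j
    rw [Matrix.of_apply, ← coeff_momentSeries]
    simp [hankelZero, hankel]
  ext m k
  rw [h, orthoMatrix_mul_mul_transpose, coeffFunctional_zero, derivFunctional_normMeixner_mul,
    Matrix.diagonal_apply]
  simp only [Fin.ext_iff]
  split_ifs <;> simp

/-- The factor 1 + (-1)^(m+k), from evaluating at both ±(1/2+2ℓ), kills entries of mixed parity and
doubles the others. -/
theorem coeff_orthoMatrix_mul_hankel (n N : ℕ) (hN : N ≠ 0) (m k : Fin (n + 1)) :
    PowerSeries.coeff N (((orthoMatrix n).map PowerSeries.C *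
      (hankel n - (hankelZero n).map PowerSeries.C) *
      ((orthoMatrix n)ᵀ).map PowerSeries.C) m k) =
    ∑ d ∈ N.divisors, if Odd d then
      alpha (d / 2) * ((1 + (-1) ^ ((m : ℕ) + (k : ℕ))) * (eta (d / 2) m * eta (d / 2) k))
      else 0 := by
  have h := orthoMatrix_mul_mul_transpose n (coeffFunctional N) m k
  have h2 : PowerSeries.coeff N (((orthoMatrix n).map PowerSeries.C *
      (hankel n - (hankelZero n).map PowerSeries.C) *
      ((orthoMatrix n)ᵀ).map PowerSeries.C) m k) = coeffFunctional N (normMeixner m * normMeixner k) := by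
    rw [← h]
    simp only [Matrix.mul_apply, map_sum, Matrix.map_apply, PowerSeries.coeff_mul_C,
      PowerSeries.coeff_C_mul, Matrix.sub_apply, map_sub, PowerSeries.coeff_C, if_neg hN, sub_zero,
      Matrix.of_apply, hankel, coeff_momentSeries]
  rw [h2, coeffFunctional_of_ne_zero N hN]
  refine Finset.sum_congr rfl fun d _ => ?_
  split_ifs
  · rw [Polynomial.eval_mul, Polynomial.eval_mul, eval_neg_normMeixner, eval_neg_normMeixner,
      ← eval_normMeixner, ← eval_normMeixner, pow_add]
    push_cast
    ring
  · rfl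

theorem qMatrixSign_apply (n : ℕ) (s : ℤˣ) (i j : ParityIndex n s) :
    qMatrixSign n s i j = lambertSeries fun d => if Odd d then
      (alpha (d / 2) * (((s : ℤ) : ℂ) * (2 * (√2 : ℝ)))) *
        (eta (d / 2) i.1 * eta (d / 2) j.1) else 0 := by
  have hstar : ∀ l m, star (eta l m) = eta l m := by
    intro l m
    rw [eta_eq]
    exact Complex.conj_ofReal _
  simp only [qMatrixSign, rankOne, Matrix.of_apply, Matrix.smul_apply, Matrix.vecMulVec_apply,
    Pi.star_apply, hstar, smul_eq_mul, mul_assoc]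

theorem blockDiagonal'_qMatrixSign_apply (n : ℕ) (x y : Σ s : ℤˣ, ParityIndex n s) :
    Matrix.blockDiagonal' (fun s : ℤˣ => qMatrixSign n s) x y = if x.1 = y.1 then
      lambertSeries fun d => if Odd d then (alpha (d / 2) *
        (((x.1 : ℤ) : ℂ) * (2 * (√2 : ℝ)))) * (eta (d / 2) x.2.1 * eta (d / 2) y.2.1) else 0
      else 0 := by
  obtain ⟨s, i⟩ := x
  obtain ⟨t, j⟩ := y
  by_cases h : s = t
  · subst h
    rw [Matrix.blockDiagonal'_apply_eq, if_pos rfl, qMatrixSign_apply]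
  · rw [Matrix.blockDiagonal'_apply_ne _ _ _ h, if_neg h]

theorem qMatrixSum_apply (n : ℕ) (i j : Fin (n + 1)) :
    qMatrixSum n i j = if (-1 : ℤˣ) ^ (i : ℕ) = (-1 : ℤˣ) ^ (j : ℕ) then
      lambertSeries fun d => if Odd d then (alpha (d / 2) *
        ((-1) ^ (i : ℕ) * (2 * ((√2 : ℝ) : ℂ)))) * (eta (d / 2) i * eta (d / 2) j) else 0
      else 0 := by
  rw [qMatrixSum, Matrix.reindex_apply, Matrix.submatrix_apply, blockDiagonal'_qMatrixSign_apply]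
  simp [Equiv.sigmaFiberEquiv]

/-- `A_n(q)` is similar to the direct sum of `A_n^+(q)` and `A_n^-(q)`. -/
theorem qMatrix_similar (n : ℕ) : (hankelZero n).det ≠ 0 ∧
    ∃ P : Matrix (Fin (n + 1)) (Fin (n + 1)) ℂ, IsUnit P.det ∧
      (P⁻¹).map (PowerSeries.C (R := ℂ)) * qMatrix n * P.map (PowerSeries.C (R := ℂ)) =
        qMatrixSum n := by
  have h := orthoMatrix_mul_hankelZero n
  have hs : ((√2 : ℝ) : ℂ) ≠ 0 := by simp
  let E : Matrix (Fin (n + 1)) (Fin (n + 1)) ℂ :=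
    Matrix.diagonal fun m => (-1 : ℂ) ^ (m : ℕ) * ((√2 : ℝ) : ℂ)
  -- With R = `orthoMatrix n`, this reads D(0)⁻¹ = Rᵀ E R. Conjugating A_n by Rᵀ therefore yields E
  -- R (D(q) - D(0)) Rᵀ, where E supplies the sign ± and the factor √2.
  have hE : E * orthoMatrix n * (hankelZero n * (orthoMatrix n)ᵀ) = 1 := by
    rw [Matrix.mul_assoc, ← Matrix.mul_assoc (orthoMatrix n), h, Matrix.diagonal_mul_diagonal,
      ← Matrix.diagonal_one]
    congr 1
    ext m
    rw [mul_mul_mul_comm, mul_inv_cancel₀ hs, ← mul_pow]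
    simp
  have hdet := congrArg Matrix.det hE
  rw [Matrix.det_mul, Matrix.det_mul (hankelZero n), Matrix.det_one] at hdet
  have h1 : (hankelZero n).det ≠ 0 := by
    intro h0
    simp [h0] at hdet
  have h2 : ((orthoMatrix n)ᵀ).det ≠ 0 := by
    intro h0
    simp [h0] at hdet
  refine ⟨h1, (orthoMatrix n)ᵀ, isUnit_iff_ne_zero.mpr h2, ?_⟩
  have hinv : ((orthoMatrix n)ᵀ)⁻¹ * (hankelZero n)⁻¹ = E * orthoMatrix n := by
    rw [← Matrix.mul_inv_rev]
    exact Matrix.inv_eq_left_inv hE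
  rw [qMatrix, ← Matrix.mul_assoc, ← Matrix.map_mul, hinv, Matrix.map_mul, Matrix.mul_assoc,
    Matrix.mul_assoc, ← Matrix.mul_assoc ((orthoMatrix n).map _)]
  ext i j N
  have hEmap : E.map PowerSeries.C =
      Matrix.diagonal fun m : Fin (n + 1) => PowerSeries.C ((-1 : ℂ) ^ (m : ℕ) * ((√2 : ℝ) : ℂ)) := by
    rw [Matrix.diagonal_map (map_zero _)]
  rw [hEmap, Matrix.diagonal_mul, PowerSeries.coeff_C_mul, qMatrixSum_apply]
  by_cases hN : N = 0
  · subst hN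
    have : PowerSeries.coeff 0 (((orthoMatrix n).map PowerSeries.C *
        (hankel n - (hankelZero n).map PowerSeries.C) *
        ((orthoMatrix n)ᵀ).map PowerSeries.C) i j) = 0 := by
      simp [Matrix.mul_apply, hankelZero]
    rw [this]
    split_ifs <;> simp [lambertSeries]
  · rw [coeff_orthoMatrix_mul_hankel n N hN]
    have hpar : ((-1 : ℤˣ) ^ (i : ℕ) = (-1 : ℤˣ) ^ (j : ℕ)) ↔ Even ((i : ℕ) + (j : ℕ)) := by
      rw [Nat.even_add]
      rcases Nat.even_or_odd (i : ℕ) with hi | hi <;> rcases Nat.even_or_odd (j : ℕ) with hj | hj <;>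
        simp [hi, hj, hi.neg_one_pow, hj.neg_one_pow, Nat.not_even_iff_odd.mpr]
    rw [Finset.mul_sum]
    split_ifs with hp
    · rw [hpar] at hp
      rw [lambertSeries, PowerSeries.coeff_mk, hp.neg_one_pow]
      refine Finset.sum_congr rfl fun d _ => ?_
      split_ifs
      · ring
      · simp
    · rw [hpar, Nat.not_even_iff_odd] at hp
      rw [hp.neg_one_pow]
      simp

/-! ### Leading coefficients of the exterior traces -/

theorem coeff_lambertSeries_odd (f : ℕ → ℂ) (k N : ℕ) (hN : N < 2 * k) :
    PowerSeries.coeff N (lambertSeries fun d => if Odd d then f (d / 2) else 0) =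
      PowerSeries.coeff N
        (∑ l ∈ Finset.range k, PowerSeries.C (f l) * lambertTerm ℂ (2 * l + 1)) := by
  simp only [lambertSeries, PowerSeries.coeff_mk, map_sum, PowerSeries.coeff_C_mul, lambertTerm,
    mul_ite, mul_one, mul_zero]
  rw [← Finset.sum_filter, ← Finset.sum_filter]
  refine Finset.sum_bij' (fun d _ => d / 2) (fun l _ => 2 * l + 1) ?_ ?_ ?_ ?_ ?_
  · intro d hd
    simp only [Finset.mem_filter, Nat.mem_divisors, Finset.mem_range] at hd ⊢
    have := Nat.le_of_dvd (Nat.pos_of_ne_zero hd.1.2) hd.1.1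
    exact ⟨by omega, hd.1.2, by rw [Nat.two_mul_div_two_add_one_of_odd hd.2]; exact hd.1.1⟩
  · intro l hl
    simp only [Finset.mem_filter, Nat.mem_divisors, Finset.mem_range] at hl ⊢
    exact ⟨⟨hl.2.2, hl.2.1⟩, odd_two_mul_add_one l⟩
  · intro d hd
    exact Nat.two_mul_div_two_add_one_of_odd (Finset.mem_filter.mp hd).2
  · intro l _
    omega
  · intro d _
    rfl

/-- Writing α_ℓ = (-1)^ℓ κ_ℓ² and ξ_ℓ = κ_ℓ η_ℓ, the weights κ_ℓ² are absorbed into the Gram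
determinant of the ξ_ℓ. What remains is 2^(3m/2) and the sign ∏ (-1)^ℓ s. -/
theorem prod_mul_det_eq_leadCoeff (n : ℕ) (s : ℤˣ) (m : ℕ) :
    (∏ l ∈ Finset.range m, (alpha l * (((s : ℤ) : ℂ) * (2 * (√2 : ℝ))))) *
      (Matrix.of fun a b : Fin m => (fun i : ParityIndex n s => eta a i.1) ⬝ᵥ
        fun i : ParityIndex n s => eta b i.1).det = (leadCoeff n s m : ℝ) := by
  let κ : ℕ → ℝ := fun l => (2 ^ l)⁻¹ * √(Nat.choose (2 * l) l : ℝ)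
  let e : ℕ → ParityIndex n s → ℝ := fun l i =>
    (2 ^ (i.1 : ℕ))⁻¹ * √(Nat.choose (2 * (i.1 : ℕ)) i.1 : ℝ) * pPoly l i.1
  let D : ℝ := (Matrix.of fun a b : Fin m => e a ⬝ᵥ e b).det
  have h1 : (Matrix.of fun a b : Fin m => (fun i : ParityIndex n s => eta a i.1) ⬝ᵥ
        fun i : ParityIndex n s => eta b i.1).det = (D : ℂ) := by
    change _ = Complex.ofRealHom D
    rw [RingHom.map_det]
    congr 1
    ext a b
    simp only [Matrix.of_apply, RingHom.mapMatrix_apply, Matrix.map_apply, dotProduct, map_sum,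
      map_mul, e, eta_eq]
    simp
  have h2 : gramDet n s m = (∏ a : Fin m, κ a) * ((∏ a : Fin m, κ a) * D) := by
    rw [gramDet, ← Matrix.det_mul_row, ← Matrix.det_mul_column]
    congr 1
    ext a b
    simp only [Matrix.of_apply, dotProduct, xi_eq, Finset.mul_sum, κ, e]
    refine Finset.sum_congr rfl fun i _ => ?_
    ring
  have h3 : ∀ l, alpha l = (((-1) ^ l * (κ l * κ l) : ℝ) : ℂ) := by
    intro l
    have hk : κ l * κ l = ((4 : ℝ) ^ l)⁻¹ * (Nat.choose (2 * l) l : ℝ) := by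
      rw [mul_mul_mul_comm, Real.mul_self_sqrt (by positivity), ← mul_inv, ← mul_pow]
      norm_num
    rw [hk, alpha, show (-4 : ℂ) = (-1) * 4 by norm_num, mul_pow, mul_inv, ← inv_pow]
    push_cast
    rw [inv_neg, inv_one, mul_assoc]
  have hsign : (∏ l ∈ Finset.range m, ((-1 : ℝ) ^ l * ((s : ℤ) : ℝ))) =
      (-1) ^ (if s = 1 then m * (m - 1) / 2 else m * (m + 1) / 2) := by
    rw [Finset.prod_mul_distrib, Finset.prod_pow_eq_pow_sum, Finset.sum_range_id, Finset.prod_const,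
      Finset.card_range]
    rcases Int.units_eq_one_or s with rfl | rfl
    · simp
    · rw [if_neg (by decide)]
      have : m * (m + 1) / 2 = m * (m - 1) / 2 + m := by
        rcases m with _ | m
        · simp
        · rw [Nat.add_sub_cancel, show (m + 1) * (m + 1 + 1) = (m + 1) * m + (m + 1) * 2 by ring,
            Nat.add_mul_div_right _ _ two_pos]
      rw [this, pow_add]
      simp
  rw [h1, leadCoeff, h2, ← hsign, ← Finset.prod_range κ]
  have h4 : ∏ l ∈ Finset.range m, (alpha l * (((s : ℤ) : ℂ) * (2 * (√2 : ℝ)))) =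
      ((∏ l ∈ Finset.range m, (((-1 : ℝ) ^ l * ((s : ℤ) : ℝ)) * (2 * √2) * (κ l * κ l)) : ℝ) : ℂ) := by
    rw [Complex.ofReal_prod]
    refine Finset.prod_congr rfl fun l _ => ?_
    rw [h3]
    push_cast
    ring
  rw [h4, ← Complex.ofReal_mul]
  congr 1
  simp only [Finset.prod_mul_distrib, Finset.prod_const, Finset.card_range]
  ring

theorem X_pow_dvd_sumMinors_qMatrixSign_sub (n : ℕ) (s : ℤˣ) (m : ℕ) :
    PowerSeries.X ^ (m ^ 2 + 1) ∣ sumMinors m (qMatrixSign n s) - PowerSeries.X ^ (m ^ 2) *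
      PowerSeries.C ((leadCoeff n s m : ℝ) : ℂ) := by
  rw [← prod_mul_det_eq_leadCoeff]
  refine X_pow_dvd_sumMinors_sub_lead (fun l => alpha l * (((s : ℤ) : ℂ) * (2 * (√2 : ℝ))))
    (fun l (i : ParityIndex n s) => eta l i.1) (qMatrixSign n s) ?_ m
  intro k i j N hN
  rw [qMatrixSign_apply]
  exact coeff_lambertSeries_odd (fun l => (alpha l * (((s : ℤ) : ℂ) * (2 * (√2 : ℝ)))) *
        (eta l i.1 * eta l j.1)) k N hN

theorem coeff_sumMinors_qMatrixSign (n : ℕ) (s : ℤˣ) (m : ℕ) :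
    (∀ j < m ^ 2, PowerSeries.coeff j (sumMinors m (qMatrixSign n s)) = 0) ∧
      PowerSeries.coeff (m ^ 2) (sumMinors m (qMatrixSign n s)) =
        ((leadCoeff n s m : ℝ) : ℂ) := by
  have h := PowerSeries.X_pow_dvd_iff.mp (X_pow_dvd_sumMinors_qMatrixSign_sub n s m)
  constructor
  · intro j hj
    have := h j (by omega)
    rwa [map_sub, PowerSeries.coeff_X_pow_mul', if_neg (by omega), sub_zero] at this
  · have := h (m ^ 2) (by omega)
    rw [map_sub, PowerSeries.coeff_X_pow_mul', if_pos le_rfl, Nat.sub_self, sub_eq_zero] at this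
    rw [this]
    simp

/-! ### Rationality and the eigenvalues -/

/-- The rational values of `p_ℓ(m)`. -/
def pRat (l m : ℕ) : ℚ :=
  ∑ k ∈ Finset.range (l + 1),
    2 ^ (3 * k) * (Nat.choose m k : ℚ) * (Nat.choose l k : ℚ) / (Nat.choose (2 * k) k : ℚ)

theorem cast_pRat (l m : ℕ) : (pRat l m : ℝ) = pPoly l m := by
  simp [pRat, pPoly]

/-- A rational matrix similar to `A_n^±(q) / √2`. -/
def ratMatrix (n : ℕ) (s : ℤˣ) : Matrix (ParityIndex n s) (ParityIndex n s) ℚ⟦X⟧ :=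
  Matrix.of fun i j => PowerSeries.mk fun N => ∑ d ∈ N.divisors, if Odd d then
    (((-4 : ℚ) ^ (d / 2))⁻¹ * (Nat.choose (2 * (d / 2)) (d / 2) : ℚ)) * (((s : ℤ) : ℚ) * 2) *
      ((2 ^ (i.1 : ℕ))⁻¹ * (2 ^ (j.1 : ℕ))⁻¹ * (Nat.choose (2 * (j.1 : ℕ)) j.1 : ℚ) *
        (pRat (d / 2) i.1 * pRat (d / 2) j.1)) else 0

theorem qMatrixSign_eq_ratMatrix (n : ℕ) (s : ℤˣ) (i j : ParityIndex n s) :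
    qMatrixSign n s i j =
      PowerSeries.C (((√2 * √(Nat.choose (2 * (i.1 : ℕ)) i.1 : ℝ) : ℝ)) : ℂ) *
        (PowerSeries.C (((√(Nat.choose (2 * (j.1 : ℕ)) j.1 : ℝ))⁻¹ : ℝ) : ℂ) *
          PowerSeries.map (algebraMap ℚ ℂ) (ratMatrix n s i j)) := by
  ext N
  rw [qMatrixSign_apply, PowerSeries.coeff_C_mul, PowerSeries.coeff_C_mul, PowerSeries.coeff_map,
    ratMatrix, Matrix.of_apply, PowerSeries.coeff_mk, lambertSeries, PowerSeries.coeff_mk, map_sum,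
    Finset.mul_sum, Finset.mul_sum]
  refine Finset.sum_congr rfl fun d _ => ?_
  split_ifs
  · have hc : (0 : ℝ) < √(Nat.choose (2 * (j.1 : ℕ)) j.1 : ℝ) := by
      have : 0 < Nat.choose (2 * (j.1 : ℕ)) j.1 := Nat.centralBinom_pos _
      positivity
    have hc2 : (((√(Nat.choose (2 * (j.1 : ℕ)) j.1 : ℝ))⁻¹ : ℝ) : ℂ) *
        (Nat.choose (2 * (j.1 : ℕ)) j.1 : ℂ) = (√(Nat.choose (2 * (j.1 : ℕ)) j.1 : ℝ) : ℝ) := by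
      rw [← Complex.ofReal_natCast, ← Complex.ofReal_mul]
      congr 1
      rw [inv_mul_eq_iff_eq_mul₀ hc.ne', Real.mul_self_sqrt (by positivity)]
    have hp : ∀ l m, ((pRat l m : ℚ) : ℂ) = ((pPoly l m : ℝ) : ℂ) := by
      intro l m
      rw [← cast_pRat]
      push_cast
      rfl
    rw [eta_eq, eta_eq, alpha, eq_ratCast]
    push_cast [hp]
    push_cast at hc2
    linear_combination (-((-4 : ℂ) ^ (d / 2))⁻¹ * (Nat.choose (2 * (d / 2)) (d / 2) : ℂ) *
      ((s : ℤ) : ℂ) * 2 * (√2 : ℝ) * (2 ^ (i.1 : ℕ))⁻¹ * (2 ^ (j.1 : ℕ))⁻¹ *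
      (√(Nat.choose (2 * (i.1 : ℕ)) i.1 : ℝ) : ℝ) * (pPoly (d / 2) i.1 : ℝ) *
      (pPoly (d / 2) j.1 : ℝ)) * hc2
  · simp

/-- In a principal minor row and column factors pair up on the same indices, each pair contributing
√2. -/
theorem sumMinors_qMatrixSign_eq (n : ℕ) (s : ℤˣ) (m : ℕ) :
    sumMinors m (qMatrixSign n s) = PowerSeries.C (((√2 : ℝ) : ℂ) ^ m) *
      PowerSeries.map (algebraMap ℚ ℂ) (sumMinors m (ratMatrix n s)) := by
  rw [map_sumMinors, sumMinors, sumMinors, Finset.mul_sum]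
  refine Finset.sum_congr rfl fun t ht => ?_
  have hcard : t.card = m := (Finset.mem_powersetCard.mp ht).2
  let u : ParityIndex n s → ℂ⟦X⟧ := fun i =>
    PowerSeries.C (((√2 * √(Nat.choose (2 * (i.1 : ℕ)) i.1 : ℝ) : ℝ)) : ℂ)
  let v : ParityIndex n s → ℂ⟦X⟧ := fun j =>
    PowerSeries.C (((√(Nat.choose (2 * (j.1 : ℕ)) j.1 : ℝ))⁻¹ : ℝ) : ℂ)
  have huv : ∀ i, u i * v i = PowerSeries.C ((√2 : ℝ) : ℂ) := by
    intro i
    have hc : √(Nat.choose (2 * (i.1 : ℕ)) i.1 : ℝ) ≠ 0 := by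
      have : 0 < Nat.choose (2 * (i.1 : ℕ)) i.1 := Nat.centralBinom_pos _
      positivity
    rw [← map_mul, ← Complex.ofReal_mul, mul_assoc, mul_inv_cancel₀ hc, mul_one]
  have hprod : PowerSeries.C (((√2 : ℝ) : ℂ) ^ m) = (∏ i : t, u i) * ∏ i : t, v i := by
    rw [← Finset.prod_mul_distrib, Finset.prod_congr rfl fun (i : t) _ => huv i]
    simp [hcard]
  rw [hprod, mul_assoc, ← Matrix.det_mul_row, ← Matrix.det_mul_column]
  congr 1
  refine Matrix.ext fun i j => ?_
  exact qMatrixSign_eq_ratMatrix n s i j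

theorem leadCoeff_ne_zero (n : ℕ) (s : ℤˣ) (m : ℕ)
    (hm : m ≤ Fintype.card (ParityIndex n s)) : leadCoeff n s m ≠ 0 := by
  rw [leadCoeff]
  refine mul_ne_zero (mul_ne_zero (pow_ne_zero _ (by norm_num)) (pow_ne_zero _ ?_))
    (gramDet_ne_zero n s m hm)
  positivity

theorem exists_sumMinors_ratMatrix_eq (n : ℕ) (s : ℤˣ) (m : ℕ)
    (hm : m ≤ Fintype.card (ParityIndex n s)) :
    ∃ u : ℚ⟦X⟧, IsUnit u ∧ sumMinors m (ratMatrix n s) = PowerSeries.X ^ (m ^ 2) * u := by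
  obtain ⟨h1, h2⟩ := coeff_sumMinors_qMatrixSign n s m
  simp only [sumMinors_qMatrixSign_eq, PowerSeries.coeff_C_mul, PowerSeries.coeff_map] at h1 h2
  have hs : ((√2 : ℝ) : ℂ) ^ m ≠ 0 := by simp
  obtain ⟨u, hu⟩ : PowerSeries.X ^ (m ^ 2) ∣ sumMinors m (ratMatrix n s) := by
    rw [PowerSeries.X_pow_dvd_iff]
    intro j hj
    simpa using (mul_eq_zero.mp (h1 j hj)).resolve_left hs
  refine ⟨u, ?_, hu⟩
  rw [hu, PowerSeries.coeff_X_pow_mul', if_pos le_rfl, Nat.sub_self] at h2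
  rw [PowerSeries.isUnit_iff_constantCoeff, isUnit_iff_ne_zero]
  intro h0
  rw [PowerSeries.coeff_zero_eq_constantCoeff_apply, h0, map_zero, mul_zero] at h2
  exact leadCoeff_ne_zero n s m hm (by exact_mod_cast h2.symm)

theorem charpoly_coeff {R ι : Type*} [CommRing R] [Fintype ι] [DecidableEq ι] (A : Matrix ι ι R)
    (i j : ℕ) (h : i + j = Fintype.card ι) : A.charpoly.coeff i = (-1) ^ j * sumMinors j A := by
  have := Matrix.charpoly_coeff_eq_sum_minors A j (by omega)
  rwa [← h, Nat.add_sub_cancel] at this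

theorem prod_X_sub_C_scaleRoots {R ι : Type*} [CommRing R] [IsDomain R] (t : Finset ι)
    (a : ι → R) (r : R) :
    (∏ i ∈ t, (Polynomial.X - Polynomial.C (a i))).scaleRoots r =
      ∏ i ∈ t, (Polynomial.X - Polynomial.C (r * a i)) := by
  classical
  induction t using Finset.induction_on with
  | empty => simp
  | insert i t hi ih =>
    rw [Finset.prod_insert hi, Finset.prod_insert hi, Polynomial.mul_scaleRoots_of_noZeroDivisors,
      ih, Polynomial.X_sub_C_scaleRoots, mul_comm r (a i)]

/-- The eigenvalues of `A_n^±(q)` are formal power series. -/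
theorem exists_eigenvalues (n : ℕ) (s : ℤˣ) :
    ∃ lam : Fin (Fintype.card (ParityIndex n s)) → PowerSeries ℂ,
      (qMatrixSign n s).charpoly = ∏ k, (Polynomial.X - Polynomial.C (lam k)) ∧
      (∀ (k : Fin (Fintype.card (ParityIndex n s))) (j : ℕ), j < 2 * (k : ℕ) + 1 →
        PowerSeries.coeff j (lam k) = 0) ∧
      ∀ (k : Fin (Fintype.card (ParityIndex n s))) (j : ℕ), ∃ r : ℚ,
        PowerSeries.coeff j (lam k) = (r : ℂ) * ((√2 : ℝ) : ℂ) := by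
  -- The splitting is carried out over ℚ⟦X⟧, with slopes starting at 1 (a = 0), so that the roots
  -- have rational coefficients. Scaling them by √2 gives the eigenvalues.
  obtain ⟨μ, hμ, hμX⟩ := exists_eq_prod_of_coeff_eq (Fintype.card (ParityIndex n s)) 0
    (ratMatrix n s).charpoly (Matrix.charpoly_monic _) (Matrix.charpoly_natDegree_eq_dim _) (by
      intro i j hij
      obtain ⟨u, hu, h⟩ := exists_sumMinors_ratMatrix_eq n s j (by omega)
      refine ⟨(-1) ^ j * u, (isUnit_one.neg.pow j).mul hu, ?_⟩
      rw [charpoly_coeff _ i j hij, h]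
      ring)
  refine ⟨fun k => PowerSeries.C ((√2 : ℝ) : ℂ) * PowerSeries.map (algebraMap ℚ ℂ) (μ k), ?_, ?_, ?_⟩
  · rw [← prod_X_sub_C_scaleRoots]
    have e : ∏ k, (Polynomial.X - Polynomial.C (PowerSeries.map (algebraMap ℚ ℂ) (μ k))) =
        (ratMatrix n s).charpoly.map (PowerSeries.map (algebraMap ℚ ℂ)) := by
      rw [hμ, Polynomial.map_prod]
      simp
    rw [e]
    ext1 i
    rw [Polynomial.coeff_scaleRoots, Polynomial.coeff_map,
      (Matrix.charpoly_monic (ratMatrix n s)).natDegree_map, Matrix.charpoly_natDegree_eq_dim]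
    rcases le_or_gt i (Fintype.card (ParityIndex n s)) with hi | hi
    · obtain ⟨j, hj⟩ := Nat.exists_eq_add_of_le hi
      rw [charpoly_coeff _ i j hj.symm, charpoly_coeff _ i j hj.symm, sumMinors_qMatrixSign_eq, hj,
        Nat.add_sub_cancel_left]
      simp only [map_mul, map_pow, map_neg, map_one]
      ring
    · rw [Polynomial.coeff_eq_zero_of_natDegree_lt, Polynomial.coeff_eq_zero_of_natDegree_lt]
      · simp
      · rwa [Matrix.charpoly_natDegree_eq_dim]
      · rwa [Matrix.charpoly_natDegree_eq_dim]
  · intro k j hj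
    have := PowerSeries.X_pow_dvd_iff.mp (hμX k) j (by omega)
    rw [PowerSeries.coeff_C_mul, PowerSeries.coeff_map, this, map_zero, mul_zero]
  · intro k j
    refine ⟨PowerSeries.coeff j (μ k), ?_⟩
    rw [PowerSeries.coeff_C_mul, PowerSeries.coeff_map, mul_comm, eq_ratCast]

end SemilocalQ

end

theorem mainTheorem3 (n : ℕ) :
    -- `A_n(q)` is well defined and similar to `A_n^+(q) ⊕ A_n^-(q)`
    ((SemilocalQ.hankelZero n).det ≠ 0 ∧
      ∃ P : Matrix (Fin (n + 1)) (Fin (n + 1)) ℂ, IsUnit P.det ∧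
        (P⁻¹).map (PowerSeries.C (R := ℂ)) * SemilocalQ.qMatrix n *
          P.map (PowerSeries.C (R := ℂ)) = SemilocalQ.qMatrixSum n) ∧
    ∀ s : ℤˣ,
      -- the eigenvalues of `A_n^±(q)`, with multiplicity
      (∃ lam : Fin (Fintype.card (SemilocalQ.ParityIndex n s)) → PowerSeries ℂ,
        (SemilocalQ.qMatrixSign n s).charpoly =
            ∏ k, (Polynomial.X - Polynomial.C (lam k)) ∧
        (∀ (k : Fin (Fintype.card (SemilocalQ.ParityIndex n s))) (j : ℕ), j < 2 * (k : ℕ) + 1 → PowerSeries.coeff j (lam k) = 0) ∧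
        (∀ (k : Fin (Fintype.card (SemilocalQ.ParityIndex n s))) (j : ℕ), ∃ r : ℚ, PowerSeries.coeff j (lam k) = (r : ℂ) * ((√2 : ℝ) : ℂ))) ∧
      -- the leading terms of the traces of the exterior powers
      (∀ m : ℕ,
        (∀ j < m ^ 2,
          PowerSeries.coeff j (SemilocalQ.traceWedge m (SemilocalQ.qMatrixSign n s)) = 0) ∧
        PowerSeries.coeff (m ^ 2) (SemilocalQ.traceWedge m (SemilocalQ.qMatrixSign n s)) =
          ((SemilocalQ.leadCoeff n s m : ℝ) : ℂ) ∧
        (m ≤ Fintype.card (SemilocalQ.ParityIndex n s) → SemilocalQ.leadCoeff n s m ≠ 0)) := by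
  exact ⟨SemilocalQ.qMatrix_similar n, fun s => ⟨SemilocalQ.exists_eigenvalues n s, fun m => by
    rw [SemilocalQ.traceWedge_eq_sumMinors]
    exact ⟨(SemilocalQ.coeff_sumMinors_qMatrixSign n s m).1,
      (SemilocalQ.coeff_sumMinors_qMatrixSign n s m).2, SemilocalQ.leadCoeff_ne_zero n s m⟩⟩⟩
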